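/- For $0<q<1$ and $b\in\mathbb{C}$ let $(b;q)_n$ ($n\in\mathbb{Z}$) be the $q$-shifted factorial, i.e. $(b;q)_n=\prod_{i=0}^{n-1}(1-bq^i)$ for $n\ge 0$ and $1/(b;q)_{-m}=\prod_{k=1}^{m}(1-bq^{-k})$ for $m\ge1$, and let $\theta_q(z)=\sum_{n\in\mathbb{Z}}q^{n(n-1)/2}z^n$ for $z\in\mathbb{C}^*$. The $q$-Borel transform of the formal bilateral series ${}_1\psi_1(0;b;q,x)=\sum_{n\in\mathbb{Z}}x^n/(b;q)_n$ is $$\psi_{\mathrm A}(\xi)=\sum_{n\in\mathbb{Z}}\frac{q^{n(n-1)/2}}{(b;q)_n}\,\xi^n ,$$ which converges for large $|\xi|$; $\psi_{\mathrm A}$ also denotes its meromorphic continuation to $\mathbb{C}^*$. The $q$-Borel-Laplace transform of ${}_1\psi_1(0;b;q,\cdot)$ along the spiral $\lambda q^{\mathbb{Z}}$, $\lambda\in\mathbb{C}^*$, is $$\widetilde\psi^{\mathrm A}_\lambda(x)=\sum_{n\in\mathbb{Z}}\frac{\psi_{\mathrm A}(\lambda q^n)}{\theta_q(\lambda q^n/x)}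 .$$ **Theorem.** Let $\beta\in\mathbb{C}\setminus\{0,-1,-2,\dots\}$, put $b=q^\beta$, and fix $\lambda\in\mathbb{C}\setminus(-\infty,0]$, with $\arg\lambda\in(-\pi,\pi)$. Let $x\in\mathbb{C}^*$ with $\lambda/x\notin(-\infty,0]$. Then for all $q<1$ sufficiently close to $1$ the value $\widetilde\psi^{\mathrm A}_\lambda((1-q)x)$ is well defined (no $(b;q)_n$ with $n\ge 0$ vanishes, the continuation $\psi_{\mathrm A}$ exists and has no pole on $\lambda q^{\mathbb{Z}}$, no denominator $\theta_q(\lambda q^n/((1-q)x))$ vanishes, and the series over $n$ converges absolutely), and $$\lim_{q\to1-0}\widetilde\psi^{\mathrm A}_\lambda\big((1-q)x\big)=\Gamma(\beta)\,x^{1-\beta}\,e^x ,$$ where $x^{1-\beta}$ is taken with the value of $\arg x$ such that $|\arg x-\arg\lambda|<\pi$. In particular, $x^{1-\beta}$ is the principal power whenever the principal arguments of $x$ and $\lambda$ differ by less than $\pi$. -/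

import Mathlib

open Filter Topology

noncomputable section

namespace QBorel

/-- The `q`-shifted factorial `(a; q)_n` for `n : ℤ`. If `a = q ^ k` with `k ≥ 1` then
`(a; q)_n = ∞` for `n ≤ -k`; there Lean's value is `0⁻¹ = 0`, so that `1 / (a; q)_n` still has
the usual value `(1 - a q⁻¹) ⋯ (1 - a q ^ n) = 0`. -/
def qShifted (a q : ℂ) : ℤ → ℂ
  | Int.ofNat n => ∏ i ∈ Finset.range n, (1 - a * q ^ i)
  | Int.negSucc n => (∏ i ∈ Finset.range (n + 1), (1 - a * (q ^ (i + 1))⁻¹))⁻¹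

/-- The theta function `θ_q(z) = ∑_{n ∈ ℤ} q ^ (n (n - 1) / 2) z ^ n`. -/
def theta (q z : ℂ) : ℂ := ∑' n : ℤ, q ^ (n * (n - 1) / 2) * z ^ n

/-- The coefficients of the formal bilateral series `₁ψ₁(a; b; q, x) = ∑ (a; q)_n / (b; q)_n x ^ n`. -/
def psi11Coeff (a b q : ℂ) (n : ℤ) : ℂ := qShifted a q n / qShifted b q n

/-- The `q`-Borel transformation of the first kind, on the coefficients of a formal
bilateral series. -/
def qBorel (q : ℂ) (c : ℤ → ℂ) (n : ℤ) : ℂ := c n * q ^ (n * (n - 1) / 2)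

/-- `F` is the meromorphic function on `ℂ ∖ {0}` whose Laurent expansion near infinity is
`∑_{n ∈ ℤ} c n ξ ^ n`. Normal form means that `F` is analytic at each of its removable
singularities (and has the value `0` at its poles), so `F` is unique on `ℂ ∖ {0}`. -/
structure IsMeromorphicSum (c : ℤ → ℂ) (F : ℂ → ℂ) : Prop where
  meromorphic : MeromorphicNFOn F {0}ᶜ
  hasSum : ∃ r : ℝ, ∀ ξ : ℂ, r < ‖ξ‖ → HasSum (fun n : ℤ => c n * ξ ^ n) (F ξ)

/-- The sum of `∑_{n ∈ ℤ} c n ξ ^ n` near infinity, continued meromorphically to `ℂ ∖ {0}`. -/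
def meromorphicSum (c : ℤ → ℂ) : ℂ → ℂ := Classical.epsilon (IsMeromorphicSum c)

/-- The `n`-th term of the `q`-Laplace transformation along the spiral `lam q ^ ℤ`. -/
def qLaplaceTerm (q lam : ℂ) (φ : ℂ → ℂ) (x : ℂ) (n : ℤ) : ℂ :=
  φ (lam * q ^ n) / theta q (lam * q ^ n / x)

/-- The `q`-Laplace transformation of the first kind. -/
def qLaplace (q lam : ℂ) (φ : ℂ → ℂ) (x : ℂ) : ℂ := ∑' n : ℤ, qLaplaceTerm q lam φ x n

/-- The `q`-Borel transform `ψ_A` of `₁ψ₁(0; b; q, ·)`, as a meromorphic function on `ℂ ∖ {0}`. -/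
def borelA (b q : ℂ) : ℂ → ℂ := meromorphicSum (qBorel q (psi11Coeff 0 b q))

/-- The `q`-Borel-Laplace transform of `₁ψ₁(0; b; q, ·)`. -/
def psiA (b q lam x : ℂ) : ℂ := qLaplace q lam (borelA b q) x

/-- Everything that enters `psiA b q lam x` is defined: the coefficients of `₁ψ₁(0; b; q, ·)` have
no zero denominator, the `q`-Borel transform has a meromorphic sum without a pole on the spiral
`lam q ^ ℤ`, no theta denominator vanishes, and the `q`-Laplace series converges. -/
structure PsiAWellDefined (b q lam x : ℂ) : Prop where
  denom_ne_zero : ∀ n : ℕ, qShifted b q n ≠ 0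
  borel : IsMeromorphicSum (qBorel q (psi11Coeff 0 b q)) (borelA b q)
  no_pole : ∀ n : ℤ, AnalyticAt ℂ (borelA b q) (lam * q ^ n)
  theta_ne_zero : ∀ n : ℤ, theta q (lam * q ^ n / x) ≠ 0
  summable : Summable (qLaplaceTerm q lam (borelA b q) x)

/-- The branch of `log x` whose imaginary part differs from `arg lam` by less than `π`
(for `x / lam` off the negative real axis). -/
def logNear (lam x : ℂ) : ℂ := Complex.log lam + Complex.log (x / lam)

/-- The power `x ^ s` for that branch of `log x`. -/
def powNear (lam x s : ℂ) : ℂ := Complex.exp (s * logNear lam x)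

end QBorel

end

/-! The transform has a closed form for each `q`, and each factor of it has a limit. Write `(z)_∞`
for `(z; q)_∞`. One resummation does the algebraic work. `hasSum_tri_mul_qExp` expands `(b q^n)_∞`
by Euler's series and regroups by `n + k`, so that `∑ q^(n(n-1)/2) ξ^n (b q^n)_∞ = θ_q(ξ) /
(-b/ξ)_∞` for `|ξ| > |b|`. It is used three times. Since `1 / (b; q)_n = (b q^n)_∞ / (b)_∞`, it
gives the continuation `ψ_A(ξ) = θ_q(ξ) / ((b)_∞ (-b/ξ)_∞)`. With `b = q` it gives the Jacobi triple
product `theta_eq_qExp`. On the spiral, quasi-periodicity of `θ_q` and the triple product turn the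
Laplace series at `X` into the same kind of series, and `hasSum_qLaplaceTerm` evaluates it as
`θ_q(λ)/θ_q(b/λ) · θ_q(qλ/(bX))/θ_q(λ/X) · (q)_∞/(b)_∞ · 1/(X)_∞`. Now put `b = q^β` and `X =
(1-q)x`. The factor `1/(X)_∞` tends to `e^x` (`tendsto_qExpInv`), and `(q)_∞/(b)_∞` is `Γ_q(β)
(1-q)^(β-1)` with `Γ_q → Γ` (`tendsto_qGamma`). The modular transformation `theta_exp_eq` writes
`θ_q(e^L)` as an explicit Gaussian times a tail that tends to `1` when `|Im L|` stays below `π` by a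
fixed margin (`tendsto_thetaTail`). The Gaussians of the four thetas combine exactly to `x^(1-β)
(1-q)^(1-β)` (`theta_quotient_eq`), which cancels the power of `1-q`. The slit-plane conditions on
`λ` and `λ/x` are what controls `Im L`, and they also select the branch. -/

namespace QBorel

/-! ### Triangular numbers and Euler's two `q`-exponential series -/

/-- The triangular numbers `n (n - 1) / 2`, for `n : ℤ`. -/
def tri (n : ℤ) : ℤ := n * (n - 1) / 2

lemma two_mul_tri (n : ℤ) : 2 * tri n = n * (n - 1) :=
  Int.mul_ediv_cancel' (Int.even_mul_pred_self n).two_dvd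

lemma tri_add (m n : ℤ) : tri (m + n) = tri m + tri n + m * n := by
  have h1 := two_mul_tri (m + n)
  have h2 := two_mul_tri m
  have h3 := two_mul_tri n
  have : 2 * tri (m + n) = 2 * (tri m + tri n + m * n) := by
    rw [h1]; linear_combination -h2 - h3
  omega

lemma tri_zero : tri 0 = 0 := rfl
lemma tri_one : tri 1 = 0 := rfl

lemma tri_succ (n : ℤ) : tri (n + 1) = tri n + n := by
  rw [tri_add, tri_one]; ring

lemma tri_neg (n : ℤ) : tri (-n) = tri n + n := by
  have h2 := two_mul_tri n
  have h3 := two_mul_tri (-n)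
  have : 2 * tri (-n) = 2 * (tri n + n) := by rw [h3]; linear_combination -h2
  omega

/-- The finite product `(q; q)_k`. -/
noncomputable def qFac (q : ℂ) (k : ℕ) : ℂ := ∏ i ∈ Finset.range k, (1 - q ^ (i + 1))

/-- Euler's series `∑ q ^ (k (k - 1) / 2) (-z) ^ k / (q; q)_k` for `(z; q)_∞`. -/
noncomputable def qExp (q z : ℂ) : ℂ := ∑' k : ℕ, q ^ tri k * (-z) ^ k / qFac q k

/-- Euler's series `∑ z ^ k / (q; q)_k` for `1 / (z; q)_∞`. -/
noncomputable def qExpInv (q z : ℂ) : ℂ := ∑' k : ℕ, z ^ k / qFac q k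

lemma summable_of_tendsto_ratio {f ρ : ℕ → ℂ} {l : ℂ} (hf : ∀ n, f (n + 1) = f n * ρ n)
    (hρ : Tendsto ρ atTop (𝓝 l)) (hl : ‖l‖ < 1) : Summable f := by
  obtain ⟨r, hlr, hr⟩ := exists_between hl
  refine summable_of_ratio_norm_eventually_le hr ?_
  filter_upwards [hρ.norm.eventually_lt_const hlr] with n hn
  rw [hf, norm_mul, mul_comm]
  exact mul_le_mul_of_nonneg_right hn.le (norm_nonneg _)

lemma hasSum_of_eq {ι : Type*} {f g : ι → ℂ} {s : ℂ} (h : ∀ i, f i = g i) (hg : HasSum g s) :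
    HasSum f s :=
  funext h ▸ hg

/-- The Cauchy product of a bilateral and a unilateral series: the shear `(n, k) ↦ (n + k, k)`
permutes the index set, and absolute convergence allows summation along its fibres. -/
lemma hasSum_laurent_mul {f : ℤ → ℂ} {g : ℕ → ℂ} {s : ℤ → ℂ} (hf : Summable f)
    (hg : Summable g) (hs : ∀ n, HasSum (fun k : ℕ => f (n + k) * g k) (s n)) :
    HasSum s ((∑' i, f i) * ∑' j, g j) := by
  let e : ℤ × ℕ ≃ ℤ × ℕ :=
    { toFun := fun p => (p.1 + p.2, p.2)
      invFun := fun p => (p.1 - p.2, p.2)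
      left_inv := fun p => by simp
      right_inv := fun p => by simp }
  have h := hf.hasSum.mul hg.hasSum (summable_mul_of_summable_norm hf.norm hg.norm)
  exact (e.hasSum_iff.mpr h).prod_fiberwise hs

variable {q : ℂ}

lemma qFac_succ (q : ℂ) (k : ℕ) : qFac q (k + 1) = qFac q k * (1 - q ^ (k + 1)) :=
  Finset.prod_range_succ _ _

lemma one_sub_pow_ne_zero (hq : ‖q‖ < 1) (k : ℕ) : 1 - q ^ (k + 1) ≠ 0 := by
  intro h
  have h1 : ‖q ^ (k + 1)‖ < 1 := by
    rw [norm_pow]; exact pow_lt_one₀ (norm_nonneg _) hq (by simp)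
  rw [← sub_eq_zero.mp h] at h1
  simp at h1

lemma qFac_ne_zero (hq : ‖q‖ < 1) (k : ℕ) : qFac q k ≠ 0 :=
  Finset.prod_ne_zero_iff.mpr fun i _ => one_sub_pow_ne_zero hq i

lemma tendsto_one_sub_pow (hq : ‖q‖ < 1) :
    Tendsto (fun k : ℕ => 1 - q ^ (k + 1)) atTop (𝓝 1) := by
  have := (tendsto_pow_atTop_nhds_zero_of_norm_lt_one hq).comp (tendsto_add_atTop_nat 1)
  simpa using this.const_sub 1

lemma summable_qExp (hq0 : q ≠ 0) (hq : ‖q‖ < 1) (z : ℂ) :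
    Summable fun k : ℕ => q ^ tri k * (-z) ^ k / qFac q k := by
  have h0 : Tendsto (fun k : ℕ => q ^ k * (-z) / (1 - q ^ (k + 1))) atTop (𝓝 0) := by
    have := ((tendsto_pow_atTop_nhds_zero_of_norm_lt_one hq).mul_const (-z)).div
      (tendsto_one_sub_pow hq) one_ne_zero
    rwa [zero_mul, zero_div] at this
  refine summable_of_tendsto_ratio (fun k => ?_) h0 (by simp)
  push_cast
  rw [tri_succ, zpow_add₀ hq0, qFac_succ, zpow_natCast]
  field_simp [qFac_ne_zero hq k, one_sub_pow_ne_zero hq k]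
  ring

lemma summable_qExpInv (hq : ‖q‖ < 1) {z : ℂ} (hz : ‖z‖ < 1) :
    Summable fun k : ℕ => z ^ k / qFac q k := by
  have h0 : Tendsto (fun k : ℕ => z / (1 - q ^ (k + 1))) atTop (𝓝 z) := by
    have := (tendsto_const_nhds (x := z)).div (tendsto_one_sub_pow hq) one_ne_zero
    rwa [div_one] at this
  refine summable_of_tendsto_ratio (fun k => ?_) h0 hz
  rw [qFac_succ, pow_succ]
  field_simp [qFac_ne_zero hq k, one_sub_pow_ne_zero hq k]

lemma qExp_zero (q : ℂ) : qExp q 0 = 1 := by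
  rw [qExp, tsum_eq_single 0]
  · simp [tri_zero, qFac]
  · intro k hk; simp [hk]

lemma qExpInv_zero (q : ℂ) : qExpInv q 0 = 1 := by
  rw [qExpInv, tsum_eq_single 0]
  · simp [qFac]
  · intro k hk; simp [hk]

lemma qExp_eq (hq0 : q ≠ 0) (hq : ‖q‖ < 1) (z : ℂ) : qExp q z = (1 - z) * qExp q (q * z) := by
  have hs := summable_qExp hq0 hq z
  have hs' := summable_qExp hq0 hq (q * z)
  have h1 : qExp q z - qExp q (q * z) = -z * qExp q (q * z) := by
    rw [qExp, qExp, ← hs.tsum_sub hs',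
      (hs.sub hs').tsum_eq_zero_add, ← tsum_mul_left]
    simp only [pow_zero, sub_self, zero_add]
    refine tsum_congr fun k => ?_
    push_cast
    rw [tri_succ, zpow_add₀ hq0, qFac_succ, zpow_natCast]
    field_simp [qFac_ne_zero hq k, one_sub_pow_ne_zero hq k]
    ring
  linear_combination h1

lemma qExpInv_eq (hq : ‖q‖ < 1) {z : ℂ} (hz : ‖z‖ < 1) :
    qExpInv q (q * z) = (1 - z) * qExpInv q z := by
  have hz' : ‖q * z‖ < 1 := by
    rw [norm_mul]; exact mul_lt_one_of_nonneg_of_lt_one_left (norm_nonneg _) hq hz.le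
  have hs := summable_qExpInv hq hz
  have hs' := summable_qExpInv hq hz'
  have h1 : qExpInv q z - qExpInv q (q * z) = z * qExpInv q z := by
    rw [qExpInv, qExpInv, ← hs.tsum_sub hs',
      (hs.sub hs').tsum_eq_zero_add, ← tsum_mul_left]
    simp only [pow_zero, sub_self, zero_add]
    refine tsum_congr fun k => ?_
    rw [qFac_succ]
    field_simp [qFac_ne_zero hq k, one_sub_pow_ne_zero hq k]
    ring
  linear_combination -h1

lemma differentiable_qExp (hq0 : q ≠ 0) (hq : ‖q‖ < 1) : Differentiable ℂ (qExp q) := by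
  intro z
  have hs := (summable_qExp hq0 hq ((‖z‖ + 1 : ℝ) : ℂ)).norm
  have := Complex.differentiableOn_tsum_of_summable_norm (F := fun (k : ℕ) (w : ℂ) =>
    q ^ tri k * (-w) ^ k / qFac q k) hs (U := Metric.ball 0 (‖z‖ + 1))
    (fun k => by fun_prop) Metric.isOpen_ball (by
      intro k w hw
      have hw' : ‖w‖ ≤ ‖z‖ + 1 := by simpa using (mem_ball_zero_iff.mp hw).le
      have h1 : ‖((‖z‖ + 1 : ℝ) : ℂ)‖ = ‖z‖ + 1 := by
        rw [Complex.norm_real, Real.norm_of_nonneg (by positivity)]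
      simp only [norm_div, norm_mul, norm_pow, norm_neg, h1]
      gcongr)
  exact this.differentiableAt (Metric.isOpen_ball.mem_nhds (by simp))

lemma continuousAt_qExpInv_zero (hq : ‖q‖ < 1) : ContinuousAt (qExpInv q) 0 := by
  have hs := (summable_qExpInv hq (z := ((1 / 2 : ℝ) : ℂ)) (by norm_num)).norm
  have := Complex.differentiableOn_tsum_of_summable_norm (F := fun (k : ℕ) (w : ℂ) =>
    w ^ k / qFac q k) hs (U := Metric.ball 0 (1 / 2))
    (fun k => by fun_prop) Metric.isOpen_ball (by
      intro k w hw
      have hw' : ‖w‖ ≤ 1 / 2 := by simpa using (mem_ball_zero_iff.mp hw).le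
      have h1 : ‖((1 / 2 : ℝ) : ℂ)‖ = 1 / 2 := by norm_num
      simp only [norm_div, norm_pow, h1]
      gcongr)
  exact (this.differentiableAt (Metric.isOpen_ball.mem_nhds (by simp))).continuousAt

/-- The functional equations make the product invariant under `z ↦ q z`; iterating and using
continuity at `0`, it equals its value there. -/
lemma qExp_mul_qExpInv (hq0 : q ≠ 0) (hq : ‖q‖ < 1) {z : ℂ} (hz : ‖z‖ < 1) :
    qExp q z * qExpInv q z = 1 := by
  have h : ∀ n : ℕ, qExp q z * qExpInv q z = qExp q (q ^ n * z) * qExpInv q (q ^ n * z) := by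
    intro n
    induction n with
    | zero => simp
    | succ n ih =>
      have hz' : ‖q ^ n * z‖ < 1 := by
        rw [norm_mul, norm_pow]
        exact mul_lt_one_of_nonneg_of_lt_one_right (pow_le_one₀ (norm_nonneg _) hq.le)
          (norm_nonneg _) hz
      rw [ih, qExp_eq hq0 hq, pow_succ', mul_assoc q, qExpInv_eq hq hz']
      ring
  have h0 : Tendsto (fun n : ℕ => q ^ n * z) atTop (𝓝 0) := by
    simpa using (tendsto_pow_atTop_nhds_zero_of_norm_lt_one hq).mul_const z
  have h1 := ((differentiable_qExp hq0 hq).continuous.tendsto 0 |>.comp h0).mul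
    ((continuousAt_qExpInv_zero hq).tendsto.comp h0)
  rw [qExp_zero, qExpInv_zero, mul_one] at h1
  refine tendsto_nhds_unique ?_ h1
  simp only [Function.comp_def, ← h]
  exact tendsto_const_nhds

lemma qExp_ne_zero_of_norm_lt_one (hq0 : q ≠ 0) (hq : ‖q‖ < 1) {z : ℂ} (hz : ‖z‖ < 1) :
    qExp q z ≠ 0 :=
  left_ne_zero_of_mul_eq_one (qExp_mul_qExpInv hq0 hq hz)

lemma qExp_zpow_nonpos (hq0 : q ≠ 0) (hq : ‖q‖ < 1) (n : ℕ) : qExp q (q ^ (-(n : ℤ))) = 0 := by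
  induction n with
  | zero => rw [qExp_eq hq0 hq]; simp
  | succ n ih =>
    rw [qExp_eq hq0 hq, ← zpow_one_add₀ hq0]
    have : (1 : ℤ) + -((n + 1 : ℕ) : ℤ) = -(n : ℤ) := by push_cast; ring
    rw [this, ih, mul_zero]

lemma qExp_eq_prod_mul (hq0 : q ≠ 0) (hq : ‖q‖ < 1) (b : ℂ) (n : ℕ) :
    qExp q b = (∏ i ∈ Finset.range n, (1 - b * q ^ i)) * qExp q (b * q ^ n) := by
  induction n with
  | zero => simp
  | succ n ih =>
    rw [ih, Finset.prod_range_succ, qExp_eq hq0 hq (b * q ^ n), pow_succ]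
    ring_nf

/-- Splitting off finitely many factors moves the argument into the unit disc, where `qExp` has an
inverse. -/
lemma qExp_ne_zero (hq0 : q ≠ 0) (hq : ‖q‖ < 1) {b : ℂ} (hb : ∀ i : ℕ, 1 - b * q ^ i ≠ 0) :
    qExp q b ≠ 0 := by
  have h0 : Tendsto (fun n : ℕ => b * q ^ n) atTop (𝓝 0) := by
    simpa using (tendsto_pow_atTop_nhds_zero_of_norm_lt_one hq).const_mul b
  obtain ⟨n, hn⟩ := (h0.norm.eventually_lt_const (by simp : ‖(0 : ℂ)‖ < 1)).exists
  rw [qExp_eq_prod_mul hq0 hq b n]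
  exact mul_ne_zero (Finset.prod_ne_zero_iff.mpr fun i _ => hb i)
    (qExp_ne_zero_of_norm_lt_one hq0 hq hn)

lemma qExp_self (hq0 : q ≠ 0) (hq : ‖q‖ < 1) (n : ℕ) :
    qExp q (q ^ (n + 1)) = qExp q q / qFac q n := by
  rw [qExp_eq_prod_mul hq0 hq q n, eq_div_iff (qFac_ne_zero hq n), qFac]
  simp only [pow_succ']
  ring

/-! ### The theta function and the Jacobi triple product -/

lemma summable_theta (hq0 : q ≠ 0) (hq : ‖q‖ < 1) (z : ℂ) :
    Summable fun n : ℤ => q ^ tri n * z ^ n := by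
  have key : ∀ w : ℂ, Summable fun n : ℕ => q ^ tri n * w ^ n := by
    intro w
    have h0 : Tendsto (fun k : ℕ => q ^ k * w) atTop (𝓝 0) := by
      simpa using (tendsto_pow_atTop_nhds_zero_of_norm_lt_one hq).mul_const w
    refine summable_of_tendsto_ratio (fun k => ?_) h0 (by simp)
    push_cast
    rw [tri_succ, zpow_add₀ hq0, zpow_natCast, pow_succ]
    ring
  refine Summable.of_nat_of_neg (by simpa using key z) ?_
  refine (key (q * z⁻¹)).congr fun n => ?_
  rw [tri_neg, zpow_add₀ hq0, mul_pow]
  simp [mul_assoc]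

lemma theta_eq_tsum (q z : ℂ) : theta q z = ∑' n : ℤ, q ^ tri n * z ^ n := rfl

lemma theta_mul (hq0 : q ≠ 0) {z : ℂ} (hz : z ≠ 0) : theta q (q * z) = theta q z / z := by
  rw [eq_div_iff hz, theta_eq_tsum, theta_eq_tsum, ← tsum_mul_right, ← (Equiv.addRight (1 : ℤ)).tsum_eq (fun n : ℤ => q ^ tri n * z ^ n)]
  refine tsum_congr fun n => ?_
  simp only [Equiv.coe_addRight]
  rw [tri_succ, zpow_add₀ hq0, mul_zpow, zpow_add_one₀ hz]
  ring

lemma theta_zpow_mul (hq0 : q ≠ 0) {z : ℂ} (hz : z ≠ 0) (n : ℤ) :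
    theta q (q ^ n * z) = theta q z * q ^ (-tri n) * z ^ (-n) := by
  have step : ∀ m : ℤ, theta q (q ^ (m + 1) * z) = theta q (q ^ m * z) * (q ^ m)⁻¹ * z⁻¹ := by
    intro m
    have hm := zpow_ne_zero m hq0
    rw [zpow_add_one₀ hq0, mul_comm _ q, mul_assoc, theta_mul hq0 (mul_ne_zero hm hz)]
    field_simp
  induction n using Int.induction_on with
  | zero => simp [tri_zero]
  | succ n ih =>
    rw [step, ih, tri_succ, neg_add, zpow_add₀ hq0, neg_add, zpow_add₀ hz, zpow_neg_one, zpow_neg q n]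
    ring
  | pred n ih =>
    have h := step (-n - 1)
    rw [sub_add_cancel, ih] at h
    have ht : tri (-n : ℤ) = tri (-n - 1) + (-n - 1) := by
      have := tri_succ (-n - 1); rwa [sub_add_cancel] at this
    have hm := zpow_ne_zero (-(n : ℤ) - 1) hq0
    have h2 : theta q (q ^ (-(n : ℤ) - 1) * z) =
        theta q z * q ^ (-tri (-n)) * z ^ (-(-(n : ℤ))) * z * q ^ (-(n : ℤ) - 1) := by
      rw [h]; field_simp
    rw [h2, ht, neg_add, zpow_add₀ hq0, zpow_neg q (-(n : ℤ) - 1), neg_sub, sub_neg_eq_add,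
      add_comm (1 : ℤ), zpow_add_one₀ hz, neg_neg]
    field_simp

/-- The Cauchy product of `θ_q(ξ)` and `1 / (-b / ξ; q)_∞`. -/
lemma hasSum_tri_mul_qExp (hq0 : q ≠ 0) (hq : ‖q‖ < 1) {b ξ : ℂ} (hb : ‖b‖ < ‖ξ‖) :
    HasSum (fun n : ℤ => q ^ tri n * ξ ^ n * qExp q (b * q ^ n))
      (theta q ξ * qExpInv q (-b / ξ)) := by
  have hξ : ξ ≠ 0 := norm_pos_iff.mp ((norm_nonneg b).trans_lt hb)
  have hbξ : ‖-b / ξ‖ < 1 := by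
    rw [norm_div, norm_neg, div_lt_one (norm_pos_iff.mpr hξ)]; exact hb
  have hf := summable_theta hq0 hq ξ
  have hg := summable_qExpInv hq hbξ
  rw [theta_eq_tsum, qExpInv]
  refine hasSum_laurent_mul hf hg fun n => ?_
  have h3 := (summable_qExp hq0 hq (b * q ^ n)).hasSum.mul_left (q ^ tri n * ξ ^ n)
  refine hasSum_of_eq (fun k => ?_) h3
  have hk : (-b / ξ) ^ k * ξ ^ k = (-b) ^ k := by rw [← mul_pow, div_mul_cancel₀ _ hξ]
  rw [tri_add, zpow_add₀ hq0, zpow_add₀ hq0, zpow_add₀ hξ, zpow_mul, zpow_natCast, zpow_natCast,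
    ← neg_mul, mul_pow, ← hk]
  ring

/-- The case `b = q` of `hasSum_tri_mul_qExp`: the coefficient `(q^(n+1))_∞` vanishes for `n < 0`
and is `(q)_∞ / (q; q)_n` for `n ≥ 0`, so the bilateral series collapses to Euler's series for
`(-z)_∞`. -/
lemma theta_eq_of_norm_lt (hq0 : q ≠ 0) (hq : ‖q‖ < 1) {z : ℂ} (hz : ‖q‖ < ‖z‖) :
    theta q z = qExp q q * qExp q (-z) * qExp q (-q / z) := by
  have hz0 : z ≠ 0 := norm_pos_iff.mp ((norm_nonneg q).trans_lt hz)
  have hqz : ‖-q / z‖ < 1 := by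
    rw [norm_div, norm_neg, div_lt_one (norm_pos_iff.mpr hz0)]; exact hz
  have h1 := hasSum_tri_mul_qExp hq0 hq hz
  have h2 : HasSum (fun n : ℤ => q ^ tri n * z ^ n * qExp q (q * q ^ n))
      (qExp q q * qExp q (-z)) := by
    have h3 := (summable_qExp hq0 hq (-z)).hasSum.mul_left (qExp q q)
    refine (Function.Injective.hasSum_iff Nat.cast_injective (f := fun n : ℤ =>
      q ^ tri n * z ^ n * qExp q (q * q ^ n)) ?_).mp ?_
    · intro n hn
      obtain ⟨m, hm⟩ : ∃ m : ℕ, n = -((m : ℤ) + 1) := by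
        refine ⟨(-n - 1).toNat, ?_⟩
        have : ¬ 0 ≤ n := fun h => hn ⟨n.toNat, Int.toNat_of_nonneg h⟩
        omega
      rw [← zpow_one_add₀ hq0, hm]
      have : (1 : ℤ) + -((m : ℤ) + 1) = -(m : ℤ) := by ring
      rw [this, qExp_zpow_nonpos hq0 hq, mul_zero]
    · refine hasSum_of_eq (fun k => ?_) h3
      rw [Function.comp_apply, zpow_natCast, zpow_natCast, neg_neg]
      rw [← pow_succ', qExp_self hq0 hq]
      ring
  rw [← h1.unique h2, mul_assoc, mul_comm (qExpInv _ _), qExp_mul_qExpInv hq0 hq hqz, mul_one]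

/-- **Jacobi triple product**. -/
theorem theta_eq_qExp (hq0 : q ≠ 0) (hq : ‖q‖ < 1) {z : ℂ} (hz : z ≠ 0) :
    theta q z = qExp q q * qExp q (-z) * qExp q (-q / z) := by
  -- The product side obeys the functional equation of `theta_mul`, so the identity spreads from
  -- `‖q‖ < ‖z‖` inwards.
  have step : ∀ w : ℂ, w ≠ 0 →
      qExp q (-(q * w)) * qExp q (-q / (q * w)) * w = qExp q (-w) * qExp q (-q / w) := by
    intro w hw
    have e1 := qExp_eq hq0 hq (-w)
    have e2 := qExp_eq hq0 hq (-q / (q * w))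
    have e3 : q * (-q / (q * w)) = -q / w := by field_simp
    rw [e3] at e2
    rw [e1, e2, show q * -w = -(q * w) by ring]
    field_simp
    ring
  have h0 : Tendsto (fun n : ℕ => ‖q‖ ^ n * ‖q‖) atTop (𝓝 0) := by
    simpa using (tendsto_pow_atTop_nhds_zero_of_lt_one (norm_nonneg q) hq).mul_const ‖q‖
  -- After `n` divisions by `q` the argument lies in the region of `theta_eq_of_norm_lt`.
  obtain ⟨n, hn⟩ := (h0.eventually_lt_const (norm_pos_iff.mpr hz)).exists
  induction n generalizing z with
  | zero => exact theta_eq_of_norm_lt hq0 hq (by simpa using hn)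
  | succ n ih =>
    have hw : z / q ≠ 0 := div_ne_zero hz hq0
    have h1 := ih hw (by
      rw [norm_div, lt_div_iff₀ (norm_pos_iff.mpr hq0)]
      rwa [pow_succ] at hn)
    have h2 := theta_mul hq0 hw
    have h3 := step (z / q) hw
    rw [mul_div_cancel₀ _ hq0] at h2 h3
    rw [h2, div_eq_iff hw, h1, mul_assoc, ← h3]
    ring

end QBorel

/-! ### Closed forms of the `q`-Borel transform and of the `q`-Laplace series -/

namespace QBorel

variable {q : ℂ}

lemma qShifted_zero (q : ℂ) (n : ℤ) : qShifted 0 q n = 1 := by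
  cases n <;> simp [qShifted]

lemma qExp_mul_zpow (hq0 : q ≠ 0) (hq : ‖q‖ < 1) {b : ℂ} (hb : ∀ i : ℕ, 1 - b * q ^ i ≠ 0)
    (n : ℤ) : qExp q (b * q ^ n) = qExp q b * (qShifted b q n)⁻¹ := by
  cases n with
  | ofNat n =>
    have h : ∏ i ∈ Finset.range n, (1 - b * q ^ i) ≠ 0 :=
      Finset.prod_ne_zero_iff.mpr fun i _ => hb i
    rw [qExp_eq_prod_mul hq0 hq b n]
    simp only [qShifted, Int.ofNat_eq_natCast, zpow_natCast]
    field_simp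
  | negSucc n =>
    -- `inv_inv` also holds at `0`, so a vanishing product at negative index needs no separate case.
    simp only [qShifted, inv_inv, zpow_negSucc]
    induction n with
    | zero =>
      rw [qExp_eq hq0 hq]
      simp only [zero_add, pow_one, Finset.range_one, Finset.prod_singleton]
      rw [mul_comm q, inv_mul_cancel_right₀ hq0, mul_comm]
    | succ n ih =>
      rw [Finset.prod_range_succ, ← mul_assoc, ← ih, qExp_eq hq0 hq, mul_comm]
      congr 2
      rw [pow_succ' q (n + 1), mul_inv]
      field_simp

/-- The meromorphic continuation of the `q`-Borel transform, in closed form. -/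
noncomputable def borelFun (b q ξ : ℂ) : ℂ := theta q ξ / (qExp q b * qExp q (-b / ξ))

lemma analyticAt_qExp_div (hq0 : q ≠ 0) (hq : ‖q‖ < 1) (b : ℂ) {ξ : ℂ} (hξ : ξ ≠ 0) :
    AnalyticAt ℂ (fun z => qExp q (b / z)) ξ :=
  ((differentiable_qExp hq0 hq).analyticAt _).comp (analyticAt_const.div analyticAt_id hξ)

lemma analyticAt_theta (hq0 : q ≠ 0) (hq : ‖q‖ < 1) {ξ : ℂ} (hξ : ξ ≠ 0) :
    AnalyticAt ℂ (theta q) ξ := by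
  have h : AnalyticAt ℂ (fun z => qExp q q * qExp q (-z) * qExp q (-q / z)) ξ :=
    (analyticAt_const.mul (((differentiable_qExp hq0 hq).analyticAt _).comp analyticAt_id.neg)).mul
      (analyticAt_qExp_div hq0 hq _ hξ)
  refine h.congr ?_
  filter_upwards [isOpen_ne.mem_nhds hξ] with z hz
  exact (theta_eq_qExp hq0 hq hz).symm

lemma meromorphicOn_borelFun (hq0 : q ≠ 0) (hq : ‖q‖ < 1) (b : ℂ) :
    MeromorphicOn (borelFun b q) {0}ᶜ := fun _ hξ =>
  (analyticAt_theta hq0 hq hξ).meromorphicAt.div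
    (analyticAt_const.mul (analyticAt_qExp_div hq0 hq _ hξ)).meromorphicAt

lemma analyticAt_borelFun (hq0 : q ≠ 0) (hq : ‖q‖ < 1) {b ξ : ℂ} (hξ : ξ ≠ 0)
    (hb : qExp q b ≠ 0) (hbξ : qExp q (-b / ξ) ≠ 0) : AnalyticAt ℂ (borelFun b q) ξ :=
  (analyticAt_theta hq0 hq hξ).div (analyticAt_const.mul (analyticAt_qExp_div hq0 hq _ hξ))
    (mul_ne_zero hb hbξ)

lemma hasSum_borelFun (hq0 : q ≠ 0) (hq : ‖q‖ < 1) {b ξ : ℂ}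
    (hb : ∀ i : ℕ, 1 - b * q ^ i ≠ 0) (hξ : ‖b‖ < ‖ξ‖) :
    HasSum (fun n : ℤ => qBorel q (psi11Coeff 0 b q) n * ξ ^ n) (borelFun b q ξ) := by
  have hξ0 : 0 < ‖ξ‖ := (norm_nonneg b).trans_lt hξ
  have hbξ : ‖-b / ξ‖ < 1 := by
    rw [norm_div, norm_neg, div_lt_one hξ0]; exact hξ
  have hE := qExp_ne_zero hq0 hq hb
  have h := (hasSum_tri_mul_qExp hq0 hq hξ).mul_left (qExp q b)⁻¹
  have hval : (qExp q b)⁻¹ * (theta q ξ * qExpInv q (-b / ξ)) = borelFun b q ξ := by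
    rw [borelFun, eq_inv_of_mul_eq_one_right (qExp_mul_qExpInv hq0 hq hbξ)]
    field_simp
  rw [hval] at h
  refine hasSum_of_eq (fun n => ?_) h
  rw [qExp_mul_zpow hq0 hq hb, qBorel, psi11Coeff, qShifted_zero, ← tri]
  field_simp

/-- The identity theorem: `F - G` has order `⊤` near infinity, hence everywhere on the connected set
`{0}ᶜ`. This gives equality on a punctured neighbourhood; normal form of `F` and analyticity of `G`
at `ξ` include the centre. -/
lemma eventuallyEq_of_eq_near_infinity {F G : ℂ → ℂ} {r : ℝ} {ξ : ℂ}
    (hF : MeromorphicNFOn F {0}ᶜ) (hG : MeromorphicOn G {0}ᶜ)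
    (h : ∀ z : ℂ, r < ‖z‖ → F z = G z) (hξ : ξ ≠ 0) (hGξ : AnalyticAt ℂ G ξ) :
    F =ᶠ[𝓝 ξ] G := by
  have hFG : MeromorphicOn (F - G) {0}ᶜ := hF.meromorphicOn.sub hG
  have hc : IsPreconnected ({0}ᶜ : Set ℂ) :=
    (isConnected_compl_singleton_of_one_lt_rank (by simp) 0).isPreconnected
  obtain ⟨w, hw⟩ : ∃ w : ℂ, max r 0 < ‖w‖ := NormedField.exists_lt_norm ℂ _
  have hw0 : w ≠ 0 := norm_pos_iff.mp ((le_max_right _ _).trans_lt hw)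
  have hwtop : meromorphicOrderAt (F - G) w = ⊤ := by
    rw [meromorphicOrderAt_eq_top_iff]
    refine eventually_nhdsWithin_of_eventually_nhds ?_
    filter_upwards [(isOpen_lt continuous_const continuous_norm).mem_nhds
      ((le_max_left r 0).trans_lt hw)] with z hz
    simp [h z hz]
  have htop : meromorphicOrderAt (F - G) ξ = ⊤ := by
    by_contra hne
    exact hFG.meromorphicOrderAt_ne_top_of_isPreconnected hc hξ hw0 hne hwtop
  rw [meromorphicOrderAt_eq_top_iff] at htop
  refine (MeromorphicNFAt.eventuallyEq_nhdsNE_iff_eventuallyEq_nhds (hF hξ)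
    hGξ.meromorphicNFAt).mp ?_
  filter_upwards [htop] with z hz
  exact sub_eq_zero.mp hz

/-- A quotient such as `borelFun` need not be in normal form at zeros of its denominator.
Normalizing leaves its values unchanged where it is analytic, in particular near infinity. -/
lemma isMeromorphicSum_toMeromorphicNFOn {c : ℤ → ℂ} {G : ℂ → ℂ} {r : ℝ} (hr : 0 ≤ r)
    (hG : MeromorphicOn G {0}ᶜ) (ha : ∀ ξ : ℂ, r < ‖ξ‖ → AnalyticAt ℂ G ξ)
    (hs : ∀ ξ : ℂ, r < ‖ξ‖ → HasSum (fun n : ℤ => c n * ξ ^ n) (G ξ)) :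
    IsMeromorphicSum c (toMeromorphicNFOn G {0}ᶜ) := by
  refine ⟨meromorphicNFOn_toMeromorphicNFOn G _, r, fun ξ hξ => ?_⟩
  have hξ0 : ξ ≠ 0 := norm_pos_iff.mp (hr.trans_lt hξ)
  rw [toMeromorphicNFOn_eq_toMeromorphicNFAt hG hξ0,
    toMeromorphicNFAt_eq_self.mpr (ha ξ hξ).meromorphicNFAt]
  exact hs ξ hξ

lemma isMeromorphicSum_borelA (hq0 : q ≠ 0) (hq : ‖q‖ < 1) {b : ℂ}
    (hb : ∀ i : ℕ, 1 - b * q ^ i ≠ 0) :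
    IsMeromorphicSum (qBorel q (psi11Coeff 0 b q)) (borelA b q) := by
  refine Classical.epsilon_spec (p := IsMeromorphicSum _) ⟨_, isMeromorphicSum_toMeromorphicNFOn
    (norm_nonneg b) (meromorphicOn_borelFun hq0 hq b) (fun ξ hξ => ?_)
    fun ξ hξ => hasSum_borelFun hq0 hq hb hξ⟩
  have hξ0 : 0 < ‖ξ‖ := (norm_nonneg b).trans_lt hξ
  refine analyticAt_borelFun hq0 hq (norm_pos_iff.mp hξ0) (qExp_ne_zero hq0 hq hb)
    (qExp_ne_zero_of_norm_lt_one hq0 hq ?_)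
  rw [norm_div, norm_neg, div_lt_one hξ0]; exact hξ

lemma borelA_eventuallyEq (hq0 : q ≠ 0) (hq : ‖q‖ < 1) {b ξ : ℂ}
    (hb : ∀ i : ℕ, 1 - b * q ^ i ≠ 0) (hξ : ξ ≠ 0) (hbξ : qExp q (-b / ξ) ≠ 0) :
    borelA b q =ᶠ[𝓝 ξ] borelFun b q := by
  have hF := isMeromorphicSum_borelA hq0 hq hb
  obtain ⟨r, hr⟩ := hF.hasSum
  exact eventuallyEq_of_eq_near_infinity hF.meromorphic (meromorphicOn_borelFun hq0 hq b)
    (r := max r ‖b‖) (fun z hz => (hr z ((le_max_left _ _).trans_lt hz)).unique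
      (hasSum_borelFun hq0 hq hb ((le_max_right _ _).trans_lt hz))) hξ
    (analyticAt_borelFun hq0 hq hξ (qExp_ne_zero hq0 hq hb) hbξ)

lemma theta_mul_zpow_ne_zero (hq0 : q ≠ 0) {z : ℂ} (hz : z ≠ 0) (h : theta q z ≠ 0) (n : ℤ) :
    theta q (q ^ n * z) ≠ 0 := by
  rw [theta_zpow_mul hq0 hz]
  exact mul_ne_zero (mul_ne_zero h (zpow_ne_zero _ hq0)) (zpow_ne_zero _ hz)

/-- By the triple product this value is a factor of `θ_q(q^(-n) b / λ)`, and quasi-periodicity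
reduces all `n` to the single condition at `b / λ`. It excludes poles on the whole spiral. -/
lemma qExp_spiral_ne_zero (hq0 : q ≠ 0) (hq : ‖q‖ < 1) {b lam : ℂ} (hb0 : b ≠ 0)
    (hlam : lam ≠ 0) (h : theta q (b / lam) ≠ 0) (n : ℤ) :
    qExp q (-b / (lam * q ^ n)) ≠ 0 := by
  have hz := div_ne_zero hb0 hlam
  have h1 := theta_mul_zpow_ne_zero hq0 hz h (-n)
  rw [theta_eq_qExp hq0 hq (mul_ne_zero (zpow_ne_zero _ hq0) hz)] at h1
  have h2 := right_ne_zero_of_mul (left_ne_zero_of_mul h1)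
  convert h2 using 2
  rw [zpow_neg]
  field_simp

/-- Ramanujan's summation of the `q`-Laplace series. -/
lemma hasSum_qLaplaceTerm (hq0 : q ≠ 0) (hq : ‖q‖ < 1) {b lam X : ℂ} (hb0 : b ≠ 0)
    (hb : ∀ i : ℕ, 1 - b * q ^ i ≠ 0) (hlam : lam ≠ 0) (hX0 : X ≠ 0) (hX : ‖X‖ < 1)
    (h1 : theta q (b / lam) ≠ 0) (h2 : theta q (lam / X) ≠ 0) :
    HasSum (qLaplaceTerm q lam (borelA b q) X)
      (theta q lam / theta q (b / lam) * (theta q (q * lam / (b * X)) / theta q (lam / X)) *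
        (qExp q q / qExp q b) * qExpInv q X) := by
  have hE := qExp_ne_zero hq0 hq hb
  -- The resummation is applied with `b` replaced by `-qλ/b` and `ξ` by `qλ/(bX)`; its convergence
  -- condition is `‖X‖ < 1`.
  have hξ' : ‖-(q * lam / b)‖ < ‖q * lam / (b * X)‖ := by
    rw [norm_neg, ← div_div, norm_div _ X, lt_div_iff₀ (norm_pos_iff.mpr hX0)]
    exact mul_lt_of_lt_one_right (norm_pos_iff.mpr (by positivity)) hX
  have key := (hasSum_tri_mul_qExp hq0 hq hξ').mul_left
    (theta q lam / theta q (b / lam) / theta q (lam / X) * (qExp q q / qExp q b))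
  have hX' : -(-(q * lam / b)) / (q * lam / (b * X)) = X := by field_simp
  rw [hX'] at key
  have hval : theta q lam / theta q (b / lam) / theta q (lam / X) * (qExp q q / qExp q b) *
      (theta q (q * lam / (b * X)) * qExpInv q X) = theta q lam / theta q (b / lam) *
      (theta q (q * lam / (b * X)) / theta q (lam / X)) * (qExp q q / qExp q b) * qExpInv q X := by
    ring
  rw [hval] at key
  refine hasSum_of_eq (fun n => ?_) key
  have hqn : q ^ n ≠ 0 := zpow_ne_zero _ hq0
  have hn := qExp_spiral_ne_zero hq0 hq hb0 hlam h1 n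
  have hξ : lam * q ^ n ≠ 0 := mul_ne_zero hlam hqn
  rw [qLaplaceTerm, (borelA_eventuallyEq hq0 hq hb hξ hn).eq_of_nhds, borelFun]
  have t1 : theta q (lam * q ^ n) = theta q lam * q ^ (-tri n) * lam ^ (-n) := by
    rw [mul_comm, theta_zpow_mul hq0 hlam]
  have t2 : theta q (lam * q ^ n / X) = theta q (lam / X) * q ^ (-tri n) * (lam / X) ^ (-n) := by
    rw [← theta_zpow_mul hq0 (div_ne_zero hlam hX0)]; congr 1; ring
  have hz := div_ne_zero hb0 hlam
  have t3 : theta q (b / lam) * q ^ (-tri (-n)) * (b / lam) ^ n =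
      qExp q q * qExp q (-b / (lam * q ^ n)) * qExp q (-(q * lam / b) * q ^ n) := by
    have := theta_eq_qExp hq0 hq (mul_ne_zero (zpow_ne_zero (-n) hq0) hz)
    rw [theta_zpow_mul hq0 hz, neg_neg] at this
    rw [this, zpow_neg]
    congr 2
    · congr 1; field_simp
    · field_simp
  -- The triple product moves the denominator `(-b/(λ q^n))_∞` of the Borel transform into the
  -- numerator factor `(-(qλ/b) q^n)_∞`.
  have e1 : qExp q q * qExp q (-(q * lam / b) * q ^ n) / theta q (b / lam) =
      q ^ (-tri (-n)) * (b / lam) ^ n / qExp q (-b / (lam * q ^ n)) := by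
    rw [div_eq_div_iff h1 hn]; linear_combination -t3
  rw [t1, t2]
  have e2 : ∀ A B C D E F G H : ℂ, A / B / C * (D / E) * (F * G * H) =
      A / C / E * F * G * (D * H / B) := by intros; ring
  rw [e2, e1, tri_neg, neg_add, zpow_add₀ hq0, div_zpow, div_zpow, div_zpow, mul_zpow, mul_zpow]
  simp only [zpow_neg]
  have l1 := zpow_ne_zero n hlam
  have l2 := zpow_ne_zero n hX0
  have l3 := zpow_ne_zero n hb0
  have l4 := zpow_ne_zero (tri n) hq0
  field_simp

lemma psiAWellDefined_of_ne_zero (hq0 : q ≠ 0) (hq : ‖q‖ < 1) {b lam X : ℂ} (hb0 : b ≠ 0)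
    (hb : ∀ i : ℕ, 1 - b * q ^ i ≠ 0) (hlam : lam ≠ 0) (hX0 : X ≠ 0) (hX : ‖X‖ < 1)
    (h1 : theta q (b / lam) ≠ 0) (h2 : theta q (lam / X) ≠ 0) :
    PsiAWellDefined b q lam X where
  denom_ne_zero n := Finset.prod_ne_zero_iff.mpr fun i _ => hb i
  borel := isMeromorphicSum_borelA hq0 hq hb
  no_pole n := by
    have hξ : lam * q ^ n ≠ 0 := mul_ne_zero hlam (zpow_ne_zero _ hq0)
    have hn := qExp_spiral_ne_zero hq0 hq hb0 hlam h1 n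
    exact (analyticAt_borelFun hq0 hq hξ (qExp_ne_zero hq0 hq hb) hn).congr
      (borelA_eventuallyEq hq0 hq hb hξ hn).symm
  theta_ne_zero n := by
    have := theta_mul_zpow_ne_zero hq0 (div_ne_zero hlam hX0) h2 n
    rwa [← mul_div_assoc, mul_comm] at this
  summable := (hasSum_qLaplaceTerm hq0 hq hb0 hb hlam hX0 hX h1 h2).summable

end QBorel

/-! ### Modular transformation and asymptotics of theta -/

namespace QBorel

/-- The factor of the modular transform of `θ_q(exp L)`, `q = exp (-h)`, that tends to `1` as
`h → 0`. -/
noncomputable def thetaTail (h : ℝ) (L : ℂ) : ℂ :=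
  jacobiTheta₂ (-(L + h / 2) / h) (2 * Real.pi * Complex.I / h)

lemma theta_exp_eq_jacobiTheta₂ (h : ℝ) (L : ℂ) :
    theta (Complex.exp (-h)) (Complex.exp L) =
      jacobiTheta₂ ((L + h / 2) / (2 * Real.pi * Complex.I)) (Complex.I * h / (2 * Real.pi)) := by
  rw [theta_eq_tsum, jacobiTheta₂]
  refine tsum_congr fun n => ?_
  have hpi : (Real.pi : ℂ) ≠ 0 := by exact_mod_cast Real.pi_ne_zero
  have ht : (2 : ℂ) * (tri n : ℂ) = n * (n - 1) := by exact_mod_cast two_mul_tri n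
  rw [jacobiTheta₂_term, ← Complex.exp_int_mul, ← Complex.exp_int_mul, ← Complex.exp_add]
  congr 1
  field_simp
  simp only [Complex.I_sq]
  linear_combination -(h : ℂ) * ht

/-- The modular transformation of `θ_q`. -/
lemma theta_exp_eq {h : ℝ} (hh : 0 < h) (L : ℂ) :
    theta (Complex.exp (-h)) (Complex.exp L) =
      1 / ((h : ℂ) / (2 * Real.pi)) ^ (1 / 2 : ℂ) * Complex.exp ((L + h / 2) ^ 2 / (2 * h)) *
        thetaTail h L := by
  have hpi : (Real.pi : ℂ) ≠ 0 := by exact_mod_cast Real.pi_ne_zero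
  have hh' : (h : ℂ) ≠ 0 := by exact_mod_cast hh.ne'
  rw [theta_exp_eq_jacobiTheta₂, jacobiTheta₂_functional_equation, thetaTail]
  congr 1
  · congr 1
    · congr 2
      linear_combination (-(h : ℂ) / (2 * Real.pi)) * Complex.I_sq
    · congr 1
      field_simp
      rw [Complex.I_sq]; ring
  · congr 1
    · field_simp
      linear_combination (L * 2 + h) * Complex.I_sq
    · field_simp
      linear_combination (-1 : ℂ) * Complex.I_sq

lemma theta_exp_ne_zero {h : ℝ} (hh : 0 < h) {L : ℂ} (hL : thetaTail h L ≠ 0) :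
    theta (Complex.exp (-h)) (Complex.exp L) ≠ 0 := by
  have hpi : (Real.pi : ℂ) ≠ 0 := by exact_mod_cast Real.pi_ne_zero
  have hh' : (h : ℂ) ≠ 0 := by exact_mod_cast hh.ne'
  rw [theta_exp_eq hh]
  refine mul_ne_zero (mul_ne_zero (one_div_ne_zero ?_) (Complex.exp_ne_zero _)) hL
  rw [Complex.cpow_def_of_ne_zero (by simp [hh', hpi])]
  exact Complex.exp_ne_zero _

lemma theta_exp_div {h : ℝ} (hh : 0 < h) (L M : ℂ) :
    theta (Complex.exp (-h)) (Complex.exp L) / theta (Complex.exp (-h)) (Complex.exp M) =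
      Complex.exp ((L - M) * (L + M + h) / (2 * h)) * (thetaTail h L / thetaTail h M) := by
  have hpi : (Real.pi : ℂ) ≠ 0 := by exact_mod_cast Real.pi_ne_zero
  have hh' : (h : ℂ) ≠ 0 := by exact_mod_cast hh.ne'
  have hc : 1 / ((h : ℂ) / (2 * Real.pi)) ^ (1 / 2 : ℂ) ≠ 0 := by
    rw [Complex.cpow_def_of_ne_zero (by simp [hh', hpi])]
    exact one_div_ne_zero (Complex.exp_ne_zero _)
  rw [theta_exp_eq hh, theta_exp_eq hh, mul_assoc, mul_assoc, mul_div_mul_left _ _ hc,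
    mul_div_mul_comm, ← Complex.exp_sub]
  congr 2
  field_simp
  ring

/-- The `n`-th term has norm `exp ((2π/h) (n Im L - π n²)) ≤ exp (-2πδn²/h)`, so only `n = 0`
survives. Since `Re L` does not enter, it may be unbounded; this is needed for `logScaled`. -/
lemma tendsto_thetaTail {α : Type*} {l : Filter α} {h : α → ℝ} {L : α → ℂ} {δ : ℝ} (hδ : 0 < δ)
    (hh : Tendsto h l (𝓝[>] 0)) (hL : ∀ᶠ a in l, |(L a).im| ≤ Real.pi - δ) :
    Tendsto (fun a => thetaTail (h a) (L a)) l (𝓝 1) := by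
  have hpi := Real.pi_pos
  have hpos : ∀ᶠ a in l, 0 < h a := hh.eventually self_mem_nhdsWithin
  have hh0 : Tendsto h l (𝓝 0) := hh.mono_right nhdsWithin_le_nhds
  have hle : ∀ᶠ a in l, h a ≤ 1 := hh0.eventually_le_const zero_lt_one
  -- For integers `|n| ≤ n²`, which lets the quadratic term absorb the linear one.
  have hterm : ∀ᶠ a in l, ∀ n : ℤ,
      ‖jacobiTheta₂_term n (-(L a + h a / 2) / h a) (2 * Real.pi * Complex.I / h a)‖ ≤
        Real.exp (-(2 * Real.pi * δ / h a) * (n : ℝ) ^ 2) := by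
    filter_upwards [hpos, hL] with a ha hLa n
    have i1 : (2 * Real.pi * Complex.I / h a : ℂ).im = 2 * Real.pi / h a := by
      rw [Complex.div_ofReal_im]; simp
    have i2 : (-(L a + h a / 2) / h a : ℂ).im = -(L a).im / h a := by
      rw [Complex.div_ofReal_im]; simp
    rw [norm_jacobiTheta₂_term, i1, i2]
    refine Real.exp_le_exp.mpr ?_
    have hn : |(n : ℝ)| ≤ (n : ℝ) ^ 2 := by
      have : |n| ≤ n ^ 2 := by
        rw [← sq_abs]
        rcases eq_or_ne n 0 with rfl | hn
        · simp
        · nlinarith [Int.one_le_abs hn]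
      exact_mod_cast this
    have h1 : (n : ℝ) * (L a).im ≤ (Real.pi - δ) * (n : ℝ) ^ 2 := by
      calc (n : ℝ) * (L a).im ≤ |(n : ℝ)| * |(L a).im| := by
            rw [← abs_mul]; exact le_abs_self _
        _ ≤ (n : ℝ) ^ 2 * (Real.pi - δ) :=
            mul_le_mul hn hLa (abs_nonneg _) (sq_nonneg _)
        _ = _ := mul_comm _ _
    have h2 : -Real.pi * (n : ℝ) ^ 2 * (2 * Real.pi / h a) - 2 * Real.pi * n * (-(L a).im / h a) =
        (2 * Real.pi / h a) * (n * (L a).im - Real.pi * (n : ℝ) ^ 2) := by ring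
    have h3 : -(2 * Real.pi * δ / h a) * (n : ℝ) ^ 2 =
        (2 * Real.pi / h a) * ((Real.pi - δ) * (n : ℝ) ^ 2 - Real.pi * (n : ℝ) ^ 2) := by ring
    rw [h2, h3]
    gcongr
  have hsum : Summable fun n : ℤ => Real.exp (-(2 * Real.pi * δ) * (n : ℝ) ^ 2) := by
    refine (summable_pow_mul_jacobiTheta₂_term_bound 0 (T := 2 * δ) (by positivity) 0).congr
      fun n => ?_
    simp only [pow_zero, one_mul]
    congr 1; ring
  have hlim : ∀ n : ℤ, Tendsto (fun a => jacobiTheta₂_term n (-(L a + h a / 2) / h a)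
      (2 * Real.pi * Complex.I / h a)) l (𝓝 (if n = 0 then 1 else 0)) := by
    intro n
    split_ifs with hn
    · subst hn
      simpa [jacobiTheta₂_term] using tendsto_const_nhds
    · refine squeeze_zero_norm' (hterm.mono fun a ha => ha n) ?_
      refine Real.tendsto_exp_atBot.comp ?_
      have hinv : Tendsto (fun a => (h a)⁻¹) l atTop := tendsto_inv_nhdsGT_zero.comp hh
      have hn2 : 0 < (n : ℝ) ^ 2 := by positivity
      have := hinv.const_mul_atTop_of_neg (r := -(2 * Real.pi * δ * (n : ℝ) ^ 2))
        (by simp only [Left.neg_neg_iff]; positivity)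
      refine this.congr fun a => ?_
      ring
  have hmain := tendsto_tsum_of_dominated_convergence hsum hlim (by
    filter_upwards [hterm, hpos, hle] with a ha hpa hla n
    refine (ha n).trans (Real.exp_le_exp.mpr ?_)
    have : 2 * Real.pi * δ ≤ 2 * Real.pi * δ / h a := by
      rw [le_div_iff₀ hpa]
      exact mul_le_of_le_one_right (by positivity) hla
    nlinarith [sq_nonneg (n : ℝ)])
  simpa [thetaTail, jacobiTheta₂] using hmain

end QBorel

/-! ### Limits of the `q`-exponentials, and integrals on a logarithmic scale -/

namespace QBorel

open MeasureTheory

lemma pow_div_qFac_eq {q : ℝ} (hq : q < 1) (y : ℂ) (k : ℕ) :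
    ((1 - q) * y) ^ k / qFac q k =
      y ^ k / ∏ i ∈ Finset.range k, ∑ j ∈ Finset.range (i + 1), (q : ℂ) ^ j := by
  have hq1 : (1 - q : ℂ) ≠ 0 := by
    exact_mod_cast (sub_pos.mpr hq).ne'
  have h : qFac q k =
      (1 - q) ^ k * ∏ i ∈ Finset.range k, ∑ j ∈ Finset.range (i + 1), (q : ℂ) ^ j := by
    rw [qFac]
    simp_rw [← mul_neg_geom_sum]
    rw [Finset.prod_mul_distrib, Finset.prod_const, Finset.card_range]
  rw [h, mul_pow, mul_div_mul_left _ _ (pow_ne_zero k hq1)]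

lemma eventually_mem_Ioo {a : ℝ} (ha : a < 1) : ∀ᶠ q : ℝ in 𝓝[<] 1, q ∈ Set.Ioo a 1 :=
  Ioo_mem_nhdsLT ha

lemma tendsto_one_sub_ofReal : Tendsto (fun q : ℝ => (1 - q : ℂ)) (𝓝[<] 1) (𝓝 0) := by
  have : ContinuousAt (fun q : ℝ => (1 - q : ℂ)) 1 := by fun_prop
  simpa using this.tendsto.mono_left nhdsWithin_le_nhds

lemma tendsto_pow_div_qFac {y : ℝ → ℂ} {y₀ : ℂ} (hy : Tendsto y (𝓝[<] 1) (𝓝 y₀)) (k : ℕ) :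
    Tendsto (fun q : ℝ => ((1 - q) * y q) ^ k / qFac q k) (𝓝[<] 1)
      (𝓝 (y₀ ^ k / (k.factorial : ℂ))) := by
  have h1 : Tendsto (fun q : ℝ => ∏ i ∈ Finset.range k, ∑ j ∈ Finset.range (i + 1), (q : ℂ) ^ j)
      (𝓝[<] 1) (𝓝 (k.factorial : ℂ)) := by
    have hc : Continuous (fun q : ℝ =>
      ∏ i ∈ Finset.range k, ∑ j ∈ Finset.range (i + 1), (q : ℂ) ^ j) := by fun_prop
    have := (hc.tendsto 1).mono_left (nhdsWithin_le_nhds (s := Set.Iio 1))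
    convert this using 2
    rw [← Finset.prod_range_add_one_eq_factorial]
    push_cast
    simp
  have h2 := (hy.pow k).div h1 (by exact_mod_cast k.factorial_ne_zero)
  refine h2.congr' ?_
  filter_upwards [self_mem_nhdsWithin] with q hq
  rw [pow_div_qFac_eq hq, Pi.div_apply]

/-- After cancelling `(1 - q)^k` the denominators are products of the `q`-integers `1 + q + ⋯ +
q^i`, which increase with `q`. The series at a fixed `p` thus dominates for all `q` in `[p, 1)`. -/
lemma norm_pow_div_qFac_le {p q R : ℝ} {y : ℂ} (hp0 : 0 < p) (hpq : p ≤ q) (hq : q < 1)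
    (hy : ‖y‖ ≤ R) (k : ℕ) :
    ‖((1 - q) * y) ^ k / qFac q k‖ ≤ ‖((1 - p) * R : ℂ) ^ k / qFac p k‖ := by
  rw [pow_div_qFac_eq hq, pow_div_qFac_eq (hpq.trans_lt hq)]
  have hn : ∀ t : ℝ, 0 ≤ t → ‖∏ i ∈ Finset.range k, ∑ j ∈ Finset.range (i + 1), (t : ℂ) ^ j‖ =
      ∏ i ∈ Finset.range k, ∑ j ∈ Finset.range (i + 1), t ^ j := by
    intro t ht
    have : ∏ i ∈ Finset.range k, ∑ j ∈ Finset.range (i + 1), (t : ℂ) ^ j =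
        ((∏ i ∈ Finset.range k, ∑ j ∈ Finset.range (i + 1), t ^ j : ℝ) : ℂ) := by push_cast; rfl
    rw [this, Complex.norm_real, Real.norm_of_nonneg]
    exact Finset.prod_nonneg fun i _ => Finset.sum_nonneg fun j _ => pow_nonneg ht j
  rw [norm_div, norm_div, norm_pow, norm_pow, hn q (hp0.le.trans hpq), hn p hp0.le,
    Complex.norm_real, Real.norm_of_nonneg ((norm_nonneg y).trans hy)]
  have hpos : 0 < ∏ i ∈ Finset.range k, ∑ j ∈ Finset.range (i + 1), p ^ j :=
    Finset.prod_pos fun i _ => Finset.sum_pos (fun j _ => pow_pos hp0 j) (by simp)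
  refine div_le_div₀ (by have := (norm_nonneg y).trans hy; positivity)
    (pow_le_pow_left₀ (norm_nonneg _) hy k) hpos ?_
  exact Finset.prod_le_prod (fun i _ => Finset.sum_nonneg fun j _ => pow_nonneg hp0.le j)
    fun i _ => Finset.sum_le_sum fun j _ => pow_le_pow_left₀ hp0.le hpq j

/-- The `q`-exponential function tends to the exponential function. -/
lemma tendsto_qExpInv {y : ℝ → ℂ} {y₀ : ℂ} (hy : Tendsto y (𝓝[<] 1) (𝓝 y₀)) :
    Tendsto (fun q : ℝ => qExpInv q ((1 - q) * y q)) (𝓝[<] 1) (𝓝 (Complex.exp y₀)) := by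
  obtain ⟨R, hR0, hR⟩ : ∃ R : ℝ, 1 ≤ R ∧ ‖y₀‖ < R :=
    ⟨‖y₀‖ + 1, by linarith [norm_nonneg y₀], lt_add_one _⟩
  obtain ⟨p, hp0, hp1, hpR⟩ : ∃ p : ℝ, 0 < p ∧ p < 1 ∧ (1 - p) * R < 1 := by
    -- This choice makes `(1 - p) R = 1/2`, inside the disc of convergence.
    refine ⟨1 - 1 / (2 * R), ?_, ?_, ?_⟩
    · have : 1 / (2 * R) < 1 := by
        rw [div_lt_one (by positivity)]; linarith
      linarith
    · have : 0 < 1 / (2 * R) := by positivity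
      linarith
    · field_simp; norm_num
  have hp1' : ‖(p : ℂ)‖ < 1 := by rwa [Complex.norm_real, Real.norm_of_nonneg hp0.le]
  have hpR' : ‖((1 - p) * R : ℂ)‖ < 1 := by
    rw [show ((1 - p) * R : ℂ) = (((1 - p) * R : ℝ) : ℂ) by push_cast; rfl, Complex.norm_real,
      Real.norm_of_nonneg (mul_nonneg (by linarith) (by linarith))]
    exact hpR
  have he : Complex.exp y₀ = ∑' k : ℕ, y₀ ^ k / (k.factorial : ℂ) := by
    rw [Complex.exp_eq_exp_ℂ, NormedSpace.exp_eq_tsum_div]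
  rw [he]
  simp only [qExpInv]
  refine tendsto_tsum_of_dominated_convergence
    (bound := fun k : ℕ => ‖((1 - p) * R : ℂ) ^ k / qFac p k‖)
    (summable_qExpInv hp1' hpR').norm (tendsto_pow_div_qFac hy) ?_
  filter_upwards [eventually_mem_Ioo hp1, hy.norm.eventually_le_const hR] with q hq hyq k
  exact norm_pow_div_qFac_le hp0 hq.1.le hq.2 hyq k

lemma tendsto_qExp {y : ℝ → ℂ} {y₀ : ℂ} (hy : Tendsto y (𝓝[<] 1) (𝓝 y₀)) :
    Tendsto (fun q : ℝ => qExp q ((1 - q) * y q)) (𝓝[<] 1) (𝓝 (Complex.exp (-y₀))) := by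
  have h := (tendsto_qExpInv hy).inv₀ (Complex.exp_ne_zero _)
  rw [← Complex.exp_neg] at h
  have h0 : Tendsto (fun q : ℝ => (1 - q : ℂ) * y q) (𝓝[<] 1) (𝓝 0) := by
    simpa using tendsto_one_sub_ofReal.mul hy
  refine h.congr' ?_
  filter_upwards [eventually_mem_Ioo zero_lt_one,
    h0.norm.eventually_lt_const (by simp : ‖(0 : ℂ)‖ < 1)] with q hq hyq
  have hq0 : (q : ℂ) ≠ 0 := by exact_mod_cast hq.1.ne'
  have hq1 : ‖(q : ℂ)‖ < 1 := by
    rw [Complex.norm_real, Real.norm_of_nonneg hq.1.le]; exact hq.2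
  exact (eq_inv_of_mul_eq_one_left (qExp_mul_qExpInv hq0 hq1 hyq)).symm

/-- Apply `1 - t ≤ exp (-t)` to each factor `1 - z q^j` and sum the geometric series of exponents.
-/
lemma norm_qExp_le {q z : ℝ} (hq0 : 0 < q) (hq1 : q < 1) (hz0 : 0 ≤ z) (hz1 : z ≤ 1) :
    ‖qExp q z‖ ≤ Real.exp (-(z / (1 - q))) := by
  have hq0' : (q : ℂ) ≠ 0 := by exact_mod_cast hq0.ne'
  have hq1' : ‖(q : ℂ)‖ < 1 := by rwa [Complex.norm_real, Real.norm_of_nonneg hq0.le]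
  have h : ∀ n : ℕ, ‖qExp q z‖ ≤ Real.exp (-(z * ∑ j ∈ Finset.range n, q ^ j)) *
      ‖qExp q ((q : ℂ) ^ n * z)‖ := by
    intro n
    induction n with
    | zero => simp
    | succ n ih =>
      refine ih.trans ?_
      have hle : q ^ n * z ≤ 1 := mul_le_one₀ (pow_le_one₀ hq0.le hq1.le) hz0 hz1
      have e1 : ‖(1 - (q : ℂ) ^ n * z)‖ ≤ Real.exp (-(q ^ n * z)) := by
        rw [show (1 - (q : ℂ) ^ n * z) = ((1 - q ^ n * z : ℝ) : ℂ) by push_cast; rfl,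
          Complex.norm_real, Real.norm_of_nonneg (by linarith)]
        have := Real.add_one_le_exp (-(q ^ n * z))
        linarith
      rw [qExp_eq hq0' hq1', norm_mul, Finset.sum_range_succ, mul_add, neg_add, Real.exp_add,
        pow_succ', mul_assoc, mul_assoc, mul_comm z (q ^ n)]
      gcongr
  have hgeo : Tendsto (fun n : ℕ => ∑ j ∈ Finset.range n, q ^ j) atTop (𝓝 (1 - q)⁻¹) :=
    (hasSum_geometric_of_lt_one hq0.le hq1).tendsto_sum_nat
  have h0 : Tendsto (fun n : ℕ => (q : ℂ) ^ n * z) atTop (𝓝 0) := by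
    simpa using (tendsto_pow_atTop_nhds_zero_of_norm_lt_one hq1').mul_const (z : ℂ)
  have h1 := (Real.continuous_exp.tendsto _).comp (hgeo.const_mul z).neg
  have h2 := ((differentiable_qExp hq0' hq1').continuous.tendsto 0).comp h0
  have h3 := h1.mul h2.norm
  rw [qExp_zero, norm_one, mul_one, ← div_eq_mul_inv] at h3
  exact ge_of_tendsto' h3 h

lemma integrable_exp_mul_exp_neg_exp {a c : ℝ} (ha : 0 < a) (hc : 0 < c) :
    Integrable fun u : ℝ => Real.exp (a * u) * Real.exp (-(c * Real.exp u)) := by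
  have h := integrableOn_rpow_mul_exp_neg_mul_rpow (p := 1) (s := a - 1) (b := c) (by linarith)
    one_pos hc
  -- Substitution `t = exp u` in the Gamma integrand on `(0, ∞)`.
  rw [← Real.range_exp, ← Set.image_univ, integrableOn_image_iff_integrableOn_abs_deriv_smul
    MeasurableSet.univ (fun x _ => (Real.hasDerivAt_exp x).hasDerivWithinAt)
    Real.exp_injective.injOn, integrableOn_univ] at h
  refine h.congr (Eventually.of_forall fun u => ?_)
  simp only [smul_eq_mul, Real.rpow_one, abs_of_pos (Real.exp_pos u)]
  rw [← Real.exp_mul, ← mul_assoc, ← Real.exp_add]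
  congr 2
  · ring
  · ring

lemma integral_exp_mul_exp_neg_exp {β : ℂ} (hβ : 0 < β.re) :
    ∫ u : ℝ, Complex.exp (β * u) * Complex.exp (-Complex.exp u) = Complex.Gamma β := by
  rw [Complex.Gamma_eq_integral hβ, Complex.GammaIntegral, ← Real.range_exp, ← Set.image_univ,
    integral_image_eq_integral_abs_deriv_smul MeasurableSet.univ
      (fun x _ => (Real.hasDerivAt_exp x).hasDerivWithinAt) Real.exp_injective.injOn,
    setIntegral_univ]
  refine integral_congr_ae (Eventually.of_forall fun u => ?_)
  simp only [abs_of_pos (Real.exp_pos u), Complex.real_smul]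
  rw [Complex.cpow_def_of_ne_zero (by exact_mod_cast (Real.exp_pos u).ne'),
    ← Complex.ofReal_log (Real.exp_pos u).le, Real.log_exp]
  push_cast
  simp only [← Complex.exp_add]
  congr 1
  ring

/-- A bilateral series is the integral of a step function with steps of width `h`, divided by `h`.
This turns the Jackson sum into an integral to which dominated convergence applies. -/
lemma hasSum_comp_floor {F : ℤ → ℂ} {c h : ℝ} (hh : 0 < h)
    (hF : Integrable fun u : ℝ => F ⌊(c - u) / h⌋) :
    HasSum F ((h⁻¹ : ℝ) • ∫ u : ℝ, F ⌊(c - u) / h⌋) := by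
  have h1 : Integrable fun t : ℝ => F ⌊t / h⌋ := by
    have := hF.comp_sub_left c
    simpa using this
  have h2 : Integrable fun s : ℝ => F ⌊s⌋ := by
    have := h1.comp_mul_left' hh.ne'
    simpa [mul_div_cancel_left₀ _ hh.ne'] using this
  have h3 : ∫ u : ℝ, F ⌊(c - u) / h⌋ = h • ∫ s : ℝ, F ⌊s⌋ := by
    rw [integral_sub_left_eq_self (fun t : ℝ => F ⌊t / h⌋) volume c,
      Measure.integral_comp_div (fun s : ℝ => F ⌊s⌋), abs_of_pos hh]
  rw [h3, smul_smul, inv_mul_cancel₀ hh.ne', one_smul]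
  refine hasSum_of_eq (fun n => ?_) h2.hasSum_intervalIntegral_comp_add_int
  rw [intervalIntegral.integral_of_le zero_le_one, integral_Ioc_eq_integral_Ioo,
    setIntegral_congr_fun (g := fun _ => F n) measurableSet_Ioo]
  · simp
  · intro x hx
    have : ⌊x + n⌋ = n := by
      rw [Int.floor_add_intCast, Int.floor_eq_zero_iff.mpr ⟨hx.1.le, hx.2⟩, zero_add]
    simp [this]

end QBorel

/-! ### The `q`-Gamma function and its limit -/

namespace QBorel

open MeasureTheory

/-- `Γ_q(β) = (1 - q) ^ (1 - β) (q; q)_∞ / (q ^ β; q)_∞`. -/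
noncomputable def qGamma (q : ℝ) (β : ℂ) : ℂ :=
  Complex.exp ((1 - β) * Real.log (1 - q)) * (qExp q q / qExp q ((q : ℂ) ^ β))

/-- The nodes of the Jackson integral for `Γ_q`, on a logarithmic scale. -/
noncomputable def jacksonNode (q : ℝ) (k : ℤ) : ℝ := -Real.log (1 - q) + Real.log q * k

/-- The terms of the Jackson integral for `Γ_q`. -/
noncomputable def jacksonTerm (q : ℝ) (β : ℂ) (k : ℤ) : ℂ :=
  Complex.exp (β * jacksonNode q k) * qExp q ((1 - q) * (q * Real.exp (jacksonNode q k)))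

lemma one_sub_mul_exp_jacksonNode {q : ℝ} (hq0 : 0 < q) (hq1 : q < 1) (k : ℤ) :
    (1 - q) * (q * Real.exp (jacksonNode q k)) = q ^ (k + 1) := by
  have h1 : 0 < 1 - q := by linarith
  rw [jacksonNode, Real.exp_add, Real.exp_neg, Real.exp_log h1, Real.exp_mul,
    Real.exp_log hq0, Real.rpow_intCast, zpow_add_one₀ hq0.ne']
  field_simp

/-- Euler's series for `1 / (q^β)_∞`, using `(q^(k+1))_∞ = (q)_∞ / (q; q)_k`. The terms with `k < 0`
vanish, so the sum may run over `ℤ`. -/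
lemma hasSum_jacksonTerm {q : ℝ} (hq0 : 0 < q) (hq1 : q < 1) {β : ℂ} (hβ : 0 < β.re) :
    HasSum (jacksonTerm q β)
      (Complex.exp (-β * Real.log (1 - q)) * (qExp q q / qExp q ((q : ℂ) ^ β))) := by
  have hq0' : (q : ℂ) ≠ 0 := by exact_mod_cast hq0.ne'
  have hq1' : ‖(q : ℂ)‖ < 1 := by rwa [Complex.norm_real, Real.norm_of_nonneg hq0.le]
  have hb : ‖(q : ℂ) ^ β‖ < 1 := by
    rw [Complex.norm_cpow_eq_rpow_re_of_pos hq0]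
    exact Real.rpow_lt_one hq0.le hq1 hβ
  have harg : ∀ k : ℤ, ((1 - q) * (q * Real.exp (jacksonNode q k)) : ℂ) = (q : ℂ) ^ (k + 1) := by
    intro k
    exact_mod_cast one_sub_mul_exp_jacksonNode hq0 hq1 k
  have h3 := (summable_qExpInv hq1' hb).hasSum.mul_left
    (Complex.exp (-β * Real.log (1 - q)) * qExp q q)
  rw [← qExpInv, eq_inv_of_mul_eq_one_right (qExp_mul_qExpInv hq0' hq1' hb), mul_assoc,
    ← div_eq_mul_inv] at h3
  refine (Function.Injective.hasSum_iff Nat.cast_injective ?_).mp (hasSum_of_eq (fun k => ?_) h3)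
  · intro n hn
    obtain ⟨m, hm⟩ : ∃ m : ℕ, n + 1 = -(m : ℤ) := by
      refine ⟨(-n - 1).toNat, ?_⟩
      have : ¬ 0 ≤ n := fun h => hn ⟨n.toNat, Int.toNat_of_nonneg h⟩
      omega
    rw [jacksonTerm, harg, hm, qExp_zpow_nonpos hq0' hq1', mul_zero]
  · rw [Function.comp_apply, jacksonTerm, harg, ← Nat.cast_add_one, zpow_natCast,
      qExp_self hq0' hq1', Complex.cpow_def_of_ne_zero hq0', ← Complex.ofReal_log hq0.le,
      ← Complex.exp_nat_mul]
    have : Complex.exp (β * jacksonNode q k) =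
        Complex.exp (-β * Real.log (1 - q)) * Complex.exp (k * (Real.log q * β)) := by
      rw [← Complex.exp_add, jacksonNode]
      congr 1
      push_cast
      ring
    rw [this]
    ring

/-- The index of the node that lies to the right of `u`. -/
noncomputable def jacksonIndex (q u : ℝ) : ℤ := ⌊(-Real.log (1 - q) - u) / -Real.log q⌋

lemma le_jacksonNode {q : ℝ} (hq0 : 0 < q) (hq1 : q < 1) (u : ℝ) :
    u ≤ jacksonNode q (jacksonIndex q u) := by
  have hh : 0 < -Real.log q := neg_pos.mpr (Real.log_neg hq0 hq1)
  have := Int.floor_le ((-Real.log (1 - q) - u) / -Real.log q)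
  rw [le_div_iff₀ hh] at this
  rw [jacksonNode, jacksonIndex]
  linarith

lemma jacksonNode_le {q : ℝ} (hq0 : 0 < q) (hq1 : q < 1) (u : ℝ) :
    jacksonNode q (jacksonIndex q u) ≤ u + -Real.log q := by
  have hh : 0 < -Real.log q := neg_pos.mpr (Real.log_neg hq0 hq1)
  have := Int.lt_floor_add_one ((-Real.log (1 - q) - u) / -Real.log q)
  rw [div_lt_iff₀ hh] at this
  rw [jacksonNode, jacksonIndex]
  linarith

lemma tendsto_neg_log : Tendsto (fun q : ℝ => -Real.log q) (𝓝[<] 1) (𝓝[>] 0) := by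
  refine tendsto_nhdsWithin_iff.mpr ⟨?_, ?_⟩
  · have := (Real.continuousAt_log one_ne_zero).neg.tendsto
    rw [Pi.neg_apply, Real.log_one, neg_zero] at this
    exact this.mono_left nhdsWithin_le_nhds
  · filter_upwards [eventually_mem_Ioo zero_lt_one] with q hq
    exact neg_pos.mpr (Real.log_neg hq.1 hq.2)

lemma tendsto_jacksonNode (u : ℝ) :
    Tendsto (fun q : ℝ => jacksonNode q (jacksonIndex q u)) (𝓝[<] 1) (𝓝 u) := by
  have h0 := tendsto_neg_log.mono_right nhdsWithin_le_nhds
  refine tendsto_of_tendsto_of_tendsto_of_le_of_le' tendsto_const_nhds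
    (by simpa using h0.const_add u : Tendsto (fun q : ℝ => u + -Real.log q) _ _) ?_ ?_
  · filter_upwards [eventually_mem_Ioo zero_lt_one] with q hq
    exact le_jacksonNode hq.1 hq.2 u
  · filter_upwards [eventually_mem_Ioo zero_lt_one] with q hq
    exact jacksonNode_le hq.1 hq.2 u

/-- A majorant independent of `q`: the node is at most `u + log 2`, which bounds the growing factor,
and at least `u`, which with `q > 1/2` bounds the decaying one. -/
lemma norm_jacksonTerm_le {q : ℝ} (hq0 : 1 / 2 < q) (hq1 : q < 1) {β : ℂ} (hβ : 0 < β.re)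
    (u : ℝ) : ‖jacksonTerm q β (jacksonIndex q u)‖ ≤
      Real.exp (β.re * Real.log 2) *
        (Real.exp (β.re * u) * Real.exp (-(1 / 2 * Real.exp u))) := by
  have hq0' : 0 < q := by linarith
  have hqc : (q : ℂ) ≠ 0 := by exact_mod_cast hq0'.ne'
  have hqn : ‖(q : ℂ)‖ < 1 := by rwa [Complex.norm_real, Real.norm_of_nonneg hq0'.le]
  have h1 := le_jacksonNode hq0' hq1 u
  have h2 := jacksonNode_le hq0' hq1 u
  set k := jacksonIndex q u
  have harg := one_sub_mul_exp_jacksonNode hq0' hq1 k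
  have hlog : -Real.log q ≤ Real.log 2 := by
    rw [← Real.log_inv]
    refine Real.log_le_log (by positivity) ?_
    rw [inv_le_comm₀ hq0' two_pos]; linarith
  have e1 : ‖Complex.exp (β * jacksonNode q k)‖ ≤
      Real.exp (β.re * Real.log 2) * Real.exp (β.re * u) := by
    rw [Complex.norm_exp, ← Real.exp_add, Complex.re_mul_ofReal]
    refine Real.exp_le_exp.mpr ?_
    rw [← mul_add]
    exact mul_le_mul_of_nonneg_left (by linarith) hβ.le
  have e2 : ‖qExp q ((1 - q) * (q * Real.exp (jacksonNode q k)))‖ ≤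
      Real.exp (-(1 / 2 * Real.exp u)) := by
    rw [show ((1 - q) * (q * Real.exp (jacksonNode q k)) : ℂ) =
      (((1 - q) * (q * Real.exp (jacksonNode q k)) : ℝ) : ℂ) by push_cast; rfl]
    rcases lt_or_ge (k + 1) 1 with hk | hk
    -- Here the argument `q^(k+1)` is at least `1`, where `norm_qExp_le` is available only at the
    -- endpoint, but `qExp` vanishes.
    · obtain ⟨m, hm⟩ : ∃ m : ℕ, k + 1 = -(m : ℤ) := ⟨(-k - 1).toNat, by omega⟩
      rw [harg, hm]
      push_cast
      rw [qExp_zpow_nonpos hqc hqn, norm_zero]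
      positivity
    · have hle : (1 - q) * (q * Real.exp (jacksonNode q k)) ≤ 1 := by
        rw [harg]
        lift k + 1 to ℕ using by omega with m
        rw [zpow_natCast]
        exact pow_le_one₀ hq0'.le hq1.le
      refine (norm_qExp_le hq0' hq1 (by rw [harg]; positivity) hle).trans ?_
      rw [mul_div_cancel_left₀ _ (by linarith : 1 - q ≠ 0)]
      gcongr
  rw [jacksonTerm, norm_mul, ← mul_assoc (Real.exp _)]
  exact mul_le_mul e1 e2 (norm_nonneg _) (by positivity)

lemma measurable_jacksonTerm (q : ℝ) (β : ℂ) :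
    Measurable fun u : ℝ => jacksonTerm q β (jacksonIndex q u) := by
  refine (Measurable.of_discrete (f := jacksonTerm q β)).comp ?_
  unfold jacksonIndex
  exact Int.measurable_floor.comp (by fun_prop)

lemma qGamma_eq_integral {q : ℝ} (hq0 : 1 / 2 < q) (hq1 : q < 1) {β : ℂ} (hβ : 0 < β.re) :
    qGamma q β = ((1 - q) / -Real.log q : ℝ) * ∫ u : ℝ, jacksonTerm q β (jacksonIndex q u) := by
  have hq0' : 0 < q := by linarith
  have hint : Integrable fun u : ℝ => jacksonTerm q β (jacksonIndex q u) :=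
    ((integrable_exp_mul_exp_neg_exp hβ one_half_pos).const_mul _).mono'
      (measurable_jacksonTerm q β).aestronglyMeasurable
      (Eventually.of_forall (norm_jacksonTerm_le hq0 hq1 hβ))
  have h1 := hasSum_comp_floor (neg_pos.mpr (Real.log_neg hq0' hq1)) hint
  have h2 := (hasSum_jacksonTerm hq0' hq1 hβ).unique h1
  have h3 : Complex.exp ((1 - β) * Real.log (1 - q)) =
      (1 - q : ℝ) * Complex.exp (-β * Real.log (1 - q)) := by
    rw [sub_mul, one_mul, sub_eq_add_neg, Complex.exp_add, ← Complex.ofReal_exp,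
      Real.exp_log (by linarith), neg_mul]
  rw [qGamma, h3, mul_assoc, h2, Complex.real_smul, ← mul_assoc, div_eq_mul_inv,
    Complex.ofReal_mul]
  rfl

lemma tendsto_one_sub_div_neg_log :
    Tendsto (fun q : ℝ => (1 - q) / -Real.log q) (𝓝[<] 1) (𝓝 1) := by
  have h := (Real.hasDerivAt_log one_ne_zero).tendsto_slope
  have h' := (h.mono_left (nhdsWithin_mono 1 (fun q (hq : q < 1) => hq.ne))).inv₀ (by simp)
  simp only [inv_one] at h'
  refine h'.congr fun q => ?_
  rw [slope_def_field, Real.log_one, sub_zero, inv_div, ← neg_sub, neg_div, div_neg]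

lemma tendsto_qGamma_of_re_pos {β : ℂ} (hβ : 0 < β.re) :
    Tendsto (fun q : ℝ => qGamma q β) (𝓝[<] 1) (𝓝 (Complex.Gamma β)) := by
  have hint : Tendsto (fun q : ℝ => ∫ u : ℝ, jacksonTerm q β (jacksonIndex q u)) (𝓝[<] 1)
      (𝓝 (∫ u : ℝ, Complex.exp (β * u) * Complex.exp (-Complex.exp u))) := by
    refine tendsto_integral_filter_of_dominated_convergence (fun u : ℝ => Real.exp (β.re * Real.log 2) *
        (Real.exp (β.re * u) * Real.exp (-(1 / 2 * Real.exp u))))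
      (Eventually.of_forall fun q => (measurable_jacksonTerm q β).aestronglyMeasurable)
      ?_ ((integrable_exp_mul_exp_neg_exp hβ one_half_pos).const_mul _)
      (Eventually.of_forall fun u => ?_)
    · filter_upwards [eventually_mem_Ioo one_half_lt_one] with q hq
      exact Eventually.of_forall (norm_jacksonTerm_le hq.1 hq.2 hβ)
    · have hn : Tendsto (fun q : ℝ => ((jacksonNode q (jacksonIndex q u) : ℝ) : ℂ)) (𝓝[<] 1)
          (𝓝 (u : ℂ)) := (Complex.continuous_ofReal.tendsto u).comp (tendsto_jacksonNode u)
      have hq : Tendsto (fun q : ℝ => (q : ℂ)) (𝓝[<] 1) (𝓝 1) := by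
        simpa using (Complex.continuous_ofReal.tendsto 1).mono_left nhdsWithin_le_nhds
      have hy : Tendsto (fun q : ℝ => (q : ℂ) * (Real.exp (jacksonNode q (jacksonIndex q u)) : ℝ))
          (𝓝[<] 1) (𝓝 (Complex.exp u)) := by
        have := hq.mul ((Complex.continuous_exp.tendsto _).comp hn)
        simpa [Function.comp_def] using this
      exact ((Complex.continuous_exp.tendsto _).comp (hn.const_mul β)).mul (tendsto_qExp hy)
  rw [integral_exp_mul_exp_neg_exp hβ] at hint
  have hc : Tendsto (fun q : ℝ => (((1 - q) / -Real.log q : ℝ) : ℂ)) (𝓝[<] 1) (𝓝 1) := by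
    have := (Complex.continuous_ofReal.tendsto 1).comp tendsto_one_sub_div_neg_log
    rwa [Complex.ofReal_one] at this
  have := hc.mul hint
  rw [one_mul] at this
  refine this.congr' ?_
  filter_upwards [eventually_mem_Ioo one_half_lt_one] with q hq
  exact (qGamma_eq_integral hq.1 hq.2 hβ).symm

lemma qGamma_add_one {q : ℝ} (hq0 : 0 < q) (hq1 : q < 1) (β : ℂ) :
    qGamma q β = qGamma q (β + 1) * ((1 - q) / (1 - (q : ℂ) ^ β)) := by
  have hq0' : (q : ℂ) ≠ 0 := by exact_mod_cast hq0.ne'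
  have hq1' : ‖(q : ℂ)‖ < 1 := by rwa [Complex.norm_real, Real.norm_of_nonneg hq0.le]
  have h3 : Complex.exp ((1 - β) * Real.log (1 - q)) =
      (1 - q) * Complex.exp ((1 - (β + 1)) * Real.log (1 - q)) := by
    rw [show (1 - β) * (Real.log (1 - q) : ℂ) =
      (Real.log (1 - q) : ℂ) + (1 - (β + 1)) * Real.log (1 - q) by ring, Complex.exp_add,
      ← Complex.ofReal_exp, Real.exp_log (by linarith)]
    push_cast; rfl
  have h4 : (q : ℂ) ^ (β + 1) = q * (q : ℂ) ^ β := by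
    rw [Complex.cpow_add _ _ hq0', Complex.cpow_one, mul_comm]
  rw [qGamma, qGamma, h3, h4, qExp_eq hq0' hq1' ((q : ℂ) ^ β)]
  simp only [div_eq_mul_inv, mul_inv]
  ring

lemma tendsto_one_sub_cpow_div (β : ℂ) :
    Tendsto (fun q : ℝ => (1 - (q : ℂ) ^ β) / (1 - q)) (𝓝[<] 1) (𝓝 β) := by
  have h : HasDerivAt (fun z : ℂ => z ^ β) β 1 := by
    simpa using (hasDerivAt_id (1 : ℂ)).cpow_const (c := β) (by simp)
  have hr : HasDerivAt (fun q : ℝ => (q : ℂ) ^ β) β 1 := by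
    have : HasDerivAt (fun z : ℂ => z ^ β) β ((1 : ℝ) : ℂ) := by simpa using h
    exact this.comp_ofReal
  have hs := hr.tendsto_slope.mono_left (nhdsWithin_mono 1 (fun q (hq : q < 1) => hq.ne))
  refine hs.congr fun q => ?_
  rw [slope_def_module, Complex.real_smul]
  push_cast
  rw [Complex.one_cpow, ← neg_sub (1 : ℂ) (q ^ β), ← neg_sub (1 : ℂ) q, inv_neg, neg_mul_neg, div_eq_inv_mul]

/-- `Γ_q` tends to `Γ` as `q → 1`. -/
theorem tendsto_qGamma {β : ℂ} (hβ : ∀ n : ℕ, β ≠ -(n : ℂ)) :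
    Tendsto (fun q : ℝ => qGamma q β) (𝓝[<] 1) (𝓝 (Complex.Gamma β)) := by
  -- Induction on the number of unit shifts that bring `β` into `Re β > 0`, through the functional
  -- equations of `Γ_q` and `Γ`.
  obtain ⟨m, hm⟩ := exists_nat_gt (-β.re)
  induction m generalizing β with
  | zero => exact tendsto_qGamma_of_re_pos (by simpa using hm)
  | succ m ih =>
    have hβ0 : β ≠ 0 := by simpa using hβ 0
    have h1 := ih (β := β + 1)
      (fun n h => hβ (n + 1) (by push_cast; linear_combination h))
      (by push_cast at hm; simp only [Complex.add_re, Complex.one_re]; linarith)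
    have h2 := h1.mul ((tendsto_one_sub_cpow_div β).inv₀ hβ0)
    rw [Complex.Gamma_add_one β hβ0, mul_comm β, mul_assoc, mul_inv_cancel₀ hβ0, mul_one] at h2
    refine h2.congr' ?_
    filter_upwards [eventually_mem_Ioo zero_lt_one] with q hq
    rw [qGamma_add_one hq.1 hq.2 β, inv_div]

end QBorel

/-! ### Assembling the limit, and the branch of the power -/

namespace QBorel

lemma tendsto_thetaTail_of_im {L : ℝ → ℂ} {t : ℝ} (ht : |t| < Real.pi)
    (hL : Tendsto (fun q => (L q).im) (𝓝[<] 1) (𝓝 t)) :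
    Tendsto (fun q : ℝ => thetaTail (-Real.log q) (L q)) (𝓝[<] 1) (𝓝 1) := by
  refine tendsto_thetaTail (δ := (Real.pi - |t|) / 2) (by linarith) tendsto_neg_log ?_
  exact hL.abs.eventually_le_const (by linarith)

lemma tendsto_ofReal_log : Tendsto (fun q : ℝ => (Real.log q : ℂ)) (𝓝[<] 1) (𝓝 0) := by
  have h : ContinuousAt (fun q : ℝ => (Real.log q : ℂ)) 1 :=
    Complex.continuous_ofReal.continuousAt.comp (Real.continuousAt_log one_ne_zero)
  simpa using h.tendsto.mono_left nhdsWithin_le_nhds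

/-- If `q^(β+i) = 1` then `log q · (β + i) = 2πin`. The imaginary part `log q · Im β` does not
involve `i` and is small, so `n = 0` for all `i` at once, which leaves the excluded `β = -i`. -/
lemma eventually_one_sub_cpow_mul_pow_ne_zero {β : ℂ} (hβ : ∀ n : ℕ, β ≠ -(n : ℂ)) :
    ∀ᶠ q : ℝ in 𝓝[<] 1, ∀ i : ℕ, 1 - (q : ℂ) ^ β * (q : ℂ) ^ i ≠ 0 := by
  have h0 : Tendsto (fun q : ℝ => Real.log q * β.im) (𝓝[<] 1) (𝓝 0) := by
    have := ((Real.continuousAt_log one_ne_zero).tendsto.mono_left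
      (nhdsWithin_le_nhds (s := Set.Iio 1))).mul_const β.im
    simpa using this
  filter_upwards [eventually_mem_Ioo zero_lt_one,
    h0.abs.eventually_lt_const (by simpa using Real.two_pi_pos : |(0 : ℝ)| < 2 * Real.pi)]
    with q hq hlt i hi
  have hq0 : (q : ℂ) ≠ 0 := by exact_mod_cast hq.1.ne'
  have hlog : Real.log q ≠ 0 := (Real.log_neg hq.1 hq.2).ne
  rw [Complex.cpow_def_of_ne_zero hq0, ← Complex.ofReal_log hq.1.le] at hi
  have hexp : Complex.exp (Real.log q * (β + i)) = 1 := by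
    rw [mul_add, Complex.exp_add, mul_comm _ (i : ℂ), Complex.exp_nat_mul, ← Complex.ofReal_exp,
      Real.exp_log hq.1]
    exact (sub_eq_zero.mp hi).symm
  obtain ⟨n, hn⟩ := Complex.exp_eq_one_iff.mp hexp
  have him : Real.log q * β.im = n * (2 * Real.pi) := by
    have := congrArg Complex.im hn
    simpa using this
  have hn0 : n = 0 := by
    rw [him, abs_mul, abs_of_pos Real.two_pi_pos, mul_lt_iff_lt_one_left Real.two_pi_pos] at hlt
    exact Int.abs_lt_one_iff.mp (by exact_mod_cast hlt)
  rw [hn0, Int.cast_zero, zero_mul, mul_eq_zero] at hn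
  rcases hn with hn | hn
  · exact hlog (by exact_mod_cast hn)
  · exact hβ i (eq_neg_of_add_eq_zero_left hn)

/-- The logarithm of `λ / ((1 - q) x)`. -/
noncomputable def logScaled (lam x : ℂ) (q : ℝ) : ℂ :=
  Complex.log (lam / x) - Real.log (1 - q)

lemma exp_logScaled {lam x : ℂ} (hlam : lam ≠ 0) (hx : x ≠ 0) {q : ℝ} (hq : q < 1) :
    Complex.exp (logScaled lam x q) = lam / ((1 - q) * x) := by
  rw [logScaled, Complex.exp_sub, Complex.exp_log (div_ne_zero hlam hx), ← Complex.ofReal_exp,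
    Real.exp_log (by linarith), div_div, mul_comm x]
  push_cast; rfl

lemma logNear_eq {lam x : ℂ} (hxlam : lam / x ∈ Complex.slitPlane) :
    logNear lam x = Complex.log lam - Complex.log (lam / x) := by
  rw [logNear, ← inv_div, Complex.log_inv _ (Complex.slitPlane_arg_ne_pi hxlam), sub_eq_add_neg]

lemma abs_im_log_lt_pi {z : ℂ} (hz : z ∈ Complex.slitPlane) : |(Complex.log z).im| < Real.pi := by
  rw [Complex.log_im]
  exact abs_lt.mpr ⟨Complex.neg_pi_lt_arg z,
    (Complex.arg_le_pi z).lt_of_ne (Complex.slitPlane_arg_ne_pi hz)⟩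

section Limit

variable {β lam x : ℂ}

lemma tendsto_thetaTail_log (hlam : lam ∈ Complex.slitPlane) :
    Tendsto (fun q : ℝ => thetaTail (-Real.log q) (Complex.log lam)) (𝓝[<] 1) (𝓝 1) :=
  tendsto_thetaTail_of_im (abs_im_log_lt_pi hlam) tendsto_const_nhds

lemma tendsto_im_of_log_add (c L : ℂ) :
    Tendsto (fun q : ℝ => (Real.log q * c + L).im) (𝓝[<] 1) (𝓝 L.im) := by
  have := (tendsto_ofReal_log.mul_const c).add_const L
  rw [zero_mul, zero_add] at this
  exact (Complex.continuous_im.tendsto _).comp this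

lemma tendsto_thetaTail_cpow_div (β : ℂ) (hlam : lam ∈ Complex.slitPlane) :
    Tendsto (fun q : ℝ => thetaTail (-Real.log q) (Real.log q * β + -Complex.log lam))
      (𝓝[<] 1) (𝓝 1) := by
  refine tendsto_thetaTail_of_im ?_ (tendsto_im_of_log_add _ _)
  rw [Complex.neg_im, abs_neg]
  exact abs_im_log_lt_pi hlam

/-- The divergent shift `-log (1 - q)` is real, so the imaginary part still tends to `arg (λ/x)`. -/
lemma tendsto_thetaTail_logScaled (c : ℂ) (hxlam : lam / x ∈ Complex.slitPlane) :
    Tendsto (fun q : ℝ => thetaTail (-Real.log q) (Real.log q * c + logScaled lam x q))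
      (𝓝[<] 1) (𝓝 1) := by
  refine tendsto_thetaTail_of_im (abs_im_log_lt_pi hxlam) ?_
  refine (tendsto_im_of_log_add c _).congr fun q => ?_
  simp [logScaled]

lemma ofReal_eq_exp {q : ℝ} (hq : 0 < q) : (q : ℂ) = Complex.exp (-(-Real.log q : ℝ)) := by
  rw [Complex.ofReal_neg, neg_neg, ← Complex.ofReal_exp, Real.exp_log hq]

lemma cpow_div_eq_exp (β : ℂ) (hlam : lam ≠ 0) {q : ℝ} (hq : 0 < q) :
    (q : ℂ) ^ β / lam = Complex.exp (Real.log q * β + -Complex.log lam) := by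
  have hq0 : (q : ℂ) ≠ 0 := by exact_mod_cast hq.ne'
  rw [Complex.exp_add, Complex.exp_neg, Complex.exp_log hlam, Complex.cpow_def_of_ne_zero hq0,
    ← Complex.ofReal_log hq.le, div_eq_mul_inv]

lemma mul_div_cpow_mul_eq_exp (β : ℂ) (hlam : lam ≠ 0) (hx : x ≠ 0) {q : ℝ} (hq0 : 0 < q)
    (hq1 : q < 1) : q * lam / ((q : ℂ) ^ β * ((1 - q) * x)) =
      Complex.exp (Real.log q * (1 - β) + logScaled lam x q) := by
  have hq0' : (q : ℂ) ≠ 0 := by exact_mod_cast hq0.ne'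
  rw [Complex.exp_add, exp_logScaled hlam hx hq1, mul_sub, mul_one, Complex.exp_sub,
    Complex.cpow_def_of_ne_zero hq0', ← Complex.ofReal_log hq0.le, ← Complex.ofReal_exp,
    Real.exp_log hq0, mul_div_mul_comm]

/-- The product of the theta quotients in the closed form of `psiA`. -/
lemma theta_quotient_eq (β : ℂ) (hlam : lam ≠ 0) (hx : x ≠ 0)
    (hxlam : lam / x ∈ Complex.slitPlane) {q : ℝ} (hq0 : 0 < q) (hq1 : q < 1) :
    theta q lam / theta q ((q : ℂ) ^ β / lam) *
      (theta q (q * lam / ((q : ℂ) ^ β * ((1 - q) * x))) / theta q (lam / ((1 - q) * x))) =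
    powNear lam x (1 - β) * Complex.exp ((1 - β) * Real.log (1 - q)) *
      (thetaTail (-Real.log q) (Complex.log lam) /
        thetaTail (-Real.log q) (Real.log q * β + -Complex.log lam) *
      (thetaTail (-Real.log q) (Real.log q * (1 - β) + logScaled lam x q) /
        thetaTail (-Real.log q) (logScaled lam x q))) := by
  have hh : 0 < -Real.log q := neg_pos.mpr (Real.log_neg hq0 hq1)
  have hh' : (Real.log q : ℂ) ≠ 0 := by exact_mod_cast (Real.log_neg hq0 hq1).ne
  have e1 := theta_exp_div hh (Complex.log lam) (Real.log q * β + -Complex.log lam)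
  have e2 := theta_exp_div hh (Real.log q * (1 - β) + logScaled lam x q) (logScaled lam x q)
  rw [← ofReal_eq_exp hq0, ← cpow_div_eq_exp β hlam hq0, Complex.exp_log hlam] at e1
  rw [← ofReal_eq_exp hq0, ← mul_div_cpow_mul_eq_exp β hlam hx hq0 hq1,
    exp_logScaled hlam hx hq1] at e2
  -- With `h = -log q` the exponents are `(1-β)(log λ + hβ/2)` and `-(1-β)(logScaled + hβ/2)`; the
  -- terms `hβ/2` cancel, so the prefactor is exact.
  rw [e1, e2, mul_mul_mul_comm, ← Complex.exp_add, powNear, ← Complex.exp_add, logNear_eq hxlam]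
  congr 2
  rw [logScaled]
  push_cast
  field_simp
  ring

lemma eventually_theta_ne_zero (β : ℂ) (hlam : lam ∈ Complex.slitPlane) (hx : x ≠ 0)
    (hxlam : lam / x ∈ Complex.slitPlane) :
    ∀ᶠ q : ℝ in 𝓝[<] 1,
      theta q ((q : ℂ) ^ β / lam) ≠ 0 ∧ theta q (lam / ((1 - q) * x)) ≠ 0 := by
  have hlam0 := Complex.slitPlane_ne_zero hlam
  have h2 := tendsto_thetaTail_logScaled 0 hxlam
  simp only [mul_zero, zero_add] at h2
  filter_upwards [eventually_mem_Ioo zero_lt_one,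
    (tendsto_thetaTail_cpow_div β hlam).eventually_ne one_ne_zero,
    h2.eventually_ne one_ne_zero] with q hq h1 h2
  have hh : 0 < -Real.log q := neg_pos.mpr (Real.log_neg hq.1 hq.2)
  have e1 := theta_exp_ne_zero hh h1
  have e2 := theta_exp_ne_zero hh h2
  rw [← ofReal_eq_exp hq.1] at e1 e2
  rw [← cpow_div_eq_exp β hlam0 hq.1] at e1
  rw [exp_logScaled hlam0 hx hq.2] at e2
  exact ⟨e1, e2⟩

lemma eventually_norm_one_sub_mul_lt_one (x : ℂ) :
    ∀ᶠ q : ℝ in 𝓝[<] 1, ‖(1 - q) * x‖ < 1 := by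
  have := (tendsto_one_sub_ofReal.mul_const x).norm
  rw [zero_mul, norm_zero] at this
  exact this.eventually_lt_const one_pos

theorem eventually_psiAWellDefined (hβ : ∀ n : ℕ, β ≠ -(n : ℂ))
    (hlam : lam ∈ Complex.slitPlane) (hx : x ≠ 0) (hxlam : lam / x ∈ Complex.slitPlane) :
    ∀ᶠ q : ℝ in 𝓝[<] 1, PsiAWellDefined ((q : ℂ) ^ β) q lam ((1 - q) * x) ∧
      psiA ((q : ℂ) ^ β) q lam ((1 - q) * x) =
        powNear lam x (1 - β) * qGamma q β * qExpInv q ((1 - q) * x) *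
        (thetaTail (-Real.log q) (Complex.log lam) /
          thetaTail (-Real.log q) (Real.log q * β + -Complex.log lam) *
        (thetaTail (-Real.log q) (Real.log q * (1 - β) + logScaled lam x q) /
          thetaTail (-Real.log q) (logScaled lam x q))) := by
  have hlam0 := Complex.slitPlane_ne_zero hlam
  filter_upwards [eventually_mem_Ioo zero_lt_one, eventually_one_sub_cpow_mul_pow_ne_zero hβ,
    eventually_theta_ne_zero β hlam hx hxlam, eventually_norm_one_sub_mul_lt_one x]
    with q hq hb hθ hX
  have hq0 : (q : ℂ) ≠ 0 := by exact_mod_cast hq.1.ne'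
  have hq1 : ‖(q : ℂ)‖ < 1 := by
    rw [Complex.norm_real, Real.norm_of_nonneg hq.1.le]; exact hq.2
  have hb0 : (q : ℂ) ^ β ≠ 0 := by simp [Complex.cpow_eq_zero_iff, hq0]
  have hX0 : (1 - q : ℂ) * x ≠ 0 :=
    mul_ne_zero (by exact_mod_cast (sub_pos.mpr hq.2).ne') hx
  refine ⟨psiAWellDefined_of_ne_zero hq0 hq1 hb0 hb hlam0 hX0 hX hθ.1 hθ.2, ?_⟩
  rw [psiA, qLaplace, (hasSum_qLaplaceTerm hq0 hq1 hb0 hb hlam0 hX0 hX hθ.1 hθ.2).tsum_eq,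
    theta_quotient_eq β hlam0 hx hxlam hq.1 hq.2, qGamma]
  ring

theorem tendsto_psiA (hβ : ∀ n : ℕ, β ≠ -(n : ℂ))
    (hlam : lam ∈ Complex.slitPlane) (hx : x ≠ 0) (hxlam : lam / x ∈ Complex.slitPlane) :
    Tendsto (fun q : ℝ => psiA ((q : ℂ) ^ β) q lam ((1 - q) * x)) (𝓝[<] 1)
      (𝓝 (Complex.Gamma β * powNear lam x (1 - β) * Complex.exp x)) := by
  have h2 := tendsto_thetaTail_logScaled 0 hxlam
  simp only [mul_zero, zero_add] at h2
  have h := (((tendsto_qGamma hβ).const_mul (powNear lam x (1 - β))).mul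
    (tendsto_qExpInv (tendsto_const_nhds (x := x)))).mul
    (((tendsto_thetaTail_log hlam).div (tendsto_thetaTail_cpow_div β hlam) one_ne_zero).mul
      ((tendsto_thetaTail_logScaled (1 - β) hxlam).div h2 one_ne_zero))
  rw [div_one, mul_one, mul_one, mul_comm (powNear _ _ _)] at h
  refine h.congr' ?_
  filter_upwards [eventually_psiAWellDefined hβ hlam hx hxlam] with q hq
  exact hq.2.symm

end Limit

lemma logNear_eq_log {lam x : ℂ} (hlam : lam ≠ 0) (hx : x ≠ 0)
    (h : |x.arg - lam.arg| < Real.pi) : logNear lam x = Complex.log x := by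
  have h' := abs_lt.mp h
  have e : Complex.exp (Complex.log x - Complex.log lam) = x / lam := by
    rw [Complex.exp_sub, Complex.exp_log hx, Complex.exp_log hlam]
  rw [logNear, ← e, Complex.log_exp (by simpa [Complex.log_im] using h'.1)
    (by simpa [Complex.log_im] using h'.2.le)]
  ring

lemma powNear_eq_cpow {lam x : ℂ} (hlam : lam ≠ 0) (hx : x ≠ 0)
    (h : |x.arg - lam.arg| < Real.pi) (s : ℂ) : powNear lam x s = x ^ s := by
  rw [powNear, logNear_eq_log hlam hx h, Complex.cpow_def_of_ne_zero hx, mul_comm]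

end QBorel

theorem mainTheorem3 (β lam : ℂ) (hβ : ∀ n : ℕ, β ≠ -(n : ℂ)) (hlam : lam ∈ Complex.slitPlane)
    (x : ℂ) (hx : x ≠ 0) (hxlam : lam / x ∈ Complex.slitPlane) :
    (∀ᶠ q : ℝ in 𝓝[<] 1, QBorel.PsiAWellDefined ((q : ℂ) ^ β) q lam ((1 - q) * x)) ∧
    Tendsto (fun q : ℝ => QBorel.psiA ((q : ℂ) ^ β) q lam ((1 - q) * x)) (𝓝[<] 1)
      (𝓝 (Complex.Gamma β * QBorel.powNear lam x (1 - β) * Complex.exp x)) ∧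
    (|x.arg - lam.arg| < Real.pi →
      Tendsto (fun q : ℝ => QBorel.psiA ((q : ℂ) ^ β) q lam ((1 - q) * x)) (𝓝[<] 1)
        (𝓝 (Complex.Gamma β * x ^ (1 - β) * Complex.exp x))) := by
  have h := QBorel.tendsto_psiA hβ hlam hx hxlam
  refine ⟨(QBorel.eventually_psiAWellDefined hβ hlam hx hxlam).mono fun q hq => hq.1, h,
    fun harg => ?_⟩
  rwa [← QBorel.powNear_eq_cpow (Complex.slitPlane_ne_zero hlam) hx harg]
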